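/- Let $\mathcal{D}$ be a separable C*-algebra and let $\mathcal{E}$ be a nonunital $\sigma$-unital C*-algebra, with multiplier algebra $\mathcal{M}(\mathcal{E})$ and corona algebra $\mathcal{C}(\mathcal{E}) = \mathcal{M}(\mathcal{E})/\mathcal{E}$. Let $\phi, \psi : \mathcal{D} \rightarrow \mathcal{C}(\mathcal{E})$ be extensions, i.e. arbitrary *-homomorphisms (Busby invariants, not assumed injective or unital). Then the following are equivalent: (a) $\phi$ and $\psi$ are asymptotically unitarily equivalent: there is a norm-continuous path $\{u_t\}_{t \in [1,\infty)}$ of unitaries in $\mathcal{C}(\mathcal{E})$ such that $\| u_t \phi(d) u_t^* - \psi(d) \| \rightarrow 0$ as $t \rightarrow \infty$ for every $d \in \mathcal{D}$; (b) $\phi$ and $\psi$ are weakly unitarily equivalent: there is a unitary $w \in \mathcal{C}(\mathcal{E})$ such that $w \phi(d) w^* = \psi(d)$ for every $d \in \mathcal{D}$. -/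

import Mathlib

open Filter Topology
open scoped MultiplierAlgebra

noncomputable section

namespace CStarExt

/-! ### The corona algebra `M(E) / E` -/

section Corona

variable (E : Type*) [NonUnitalCStarAlgebra E]

/-- The canonical copy of `E` inside its multiplier algebra, as a left ideal
(it is two-sided, see the instance below). -/
def canonicalIdeal : Ideal 𝓜(ℂ, E) where
  carrier := Set.range (fun a : E => (a : 𝓜(ℂ, E)))
  add_mem' := by
    rintro _ _ ⟨a, rfl⟩ ⟨b, rfl⟩
    exact ⟨a + b, map_add (DoubleCentralizer.coeHom (𝕜 := ℂ) (A := E)) a b⟩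
  zero_mem' := ⟨0, map_zero (DoubleCentralizer.coeHom (𝕜 := ℂ) (A := E))⟩
  smul_mem' := by
    rintro m _ ⟨a, rfl⟩
    refine ⟨m.fst a, DoubleCentralizer.ext _ _ _ _ (Prod.ext ?_ ?_)⟩
    · ext y
      have h2 : ∀ c, c * (m.fst a * y - m.fst (a * y)) = 0 := by
        intro c
        rw [mul_sub, ← mul_assoc, ← m.central, ← m.central, mul_assoc, sub_self]
      have h3 := h2 (star (m.fst a * y - m.fst (a * y)))
      rw [CStarRing.star_mul_self_eq_zero_iff, sub_eq_zero] at h3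
      simpa using h3
    · ext y
      simpa using (m.central y a).symm

variable {E}

lemma mem_canonicalIdeal {m : 𝓜(ℂ, E)} :
    m ∈ canonicalIdeal E ↔ ∃ a : E, (a : 𝓜(ℂ, E)) = m := Iff.rfl

lemma star_mem_canonicalIdeal {m : 𝓜(ℂ, E)} (hm : m ∈ canonicalIdeal E) :
    star m ∈ canonicalIdeal E := by
  obtain ⟨a, rfl⟩ := hm
  exact ⟨star a, map_star (DoubleCentralizer.coeHom (𝕜 := ℂ) (A := E)) a⟩

instance : (canonicalIdeal E).IsTwoSided where
  mul_mem_of_left {a} b ha := by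
    have h := star_mem_canonicalIdeal
      ((canonicalIdeal E).mul_mem_left (star b) (star_mem_canonicalIdeal ha))
    simpa using h

lemma norm_coe_multiplier (a : E) : ‖(a : 𝓜(ℂ, E))‖ = ‖a‖ := by
  rw [← DoubleCentralizer.norm_fst, DoubleCentralizer.coe_fst,
    ContinuousLinearMap.opNorm_mul_apply]

instance isClosed_canonicalIdeal : IsClosed (canonicalIdeal E : Set 𝓜(ℂ, E)) := by
  have h : Isometry (DoubleCentralizer.coeHom (𝕜 := ℂ) (A := E)) :=
    AddMonoidHomClass.isometry_of_norm _ norm_coe_multiplier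
  exact h.isClosedEmbedding.isClosed_range

variable (E)

/-- The corona algebra `C(E) = M(E) / E`, with the quotient `*`-algebra structure and the
quotient norm. -/
def Corona : Type _ := 𝓜(ℂ, E) ⧸ canonicalIdeal E

namespace Corona

instance : Ring (Corona E) := inferInstanceAs (Ring (𝓜(ℂ, E) ⧸ canonicalIdeal E))

instance : Algebra ℂ (Corona E) := inferInstanceAs (Algebra ℂ (𝓜(ℂ, E) ⧸ canonicalIdeal E))

instance : NormedAddCommGroup (Corona E) :=
  inferInstanceAs (NormedAddCommGroup (𝓜(ℂ, E) ⧸ canonicalIdeal E))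

instance : NormedSpace ℂ (Corona E) :=
  inferInstanceAs (NormedSpace ℂ (𝓜(ℂ, E) ⧸ canonicalIdeal E))

instance : CompleteSpace (Corona E) :=
  inferInstanceAs (CompleteSpace (𝓜(ℂ, E) ⧸ canonicalIdeal E))

/-- The quotient map `π : M(E) → C(E)`. -/
def mk : 𝓜(ℂ, E) →ₐ[ℂ] Corona E := Ideal.Quotient.mkₐ ℂ (canonicalIdeal E)

variable {E}

lemma mk_surjective : Function.Surjective (mk E) := Ideal.Quotient.mk_surjective

lemma mk_eq_mk {m n : 𝓜(ℂ, E)} : mk E m = mk E n ↔ ∃ a : E, (a : 𝓜(ℂ, E)) = m - n :=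
  Ideal.Quotient.eq.trans mem_canonicalIdeal

lemma norm_mk_le (m : 𝓜(ℂ, E)) : ‖mk E m‖ ≤ ‖m‖ :=
  Submodule.Quotient.norm_mk_le (canonicalIdeal E) m

lemma exists_norm_lt (x : Corona E) {ε : ℝ} (hε : 0 < ε) :
    ∃ m : 𝓜(ℂ, E), mk E m = x ∧ ‖m‖ < ‖x‖ + ε :=
  Submodule.Quotient.norm_mk_lt (S := canonicalIdeal E) x hε

instance : Star (Corona E) where
  star := Quotient.lift (fun m : 𝓜(ℂ, E) => mk E (star m)) (by
    intro m n h
    have h' : m - n ∈ canonicalIdeal E := (Submodule.quotientRel_def _).1 h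
    exact mk_eq_mk.2 (by
      obtain ⟨a, ha⟩ := star_mem_canonicalIdeal h'
      exact ⟨a, by simpa using ha⟩))

lemma star_mk (m : 𝓜(ℂ, E)) : star (mk E m) = mk E (star m) := rfl

instance : StarRing (Corona E) where
  star_involutive x := by
    obtain ⟨m, rfl⟩ := mk_surjective x
    simp [star_mk]
  star_mul x y := by
    obtain ⟨m, rfl⟩ := mk_surjective x
    obtain ⟨n, rfl⟩ := mk_surjective y
    simp [star_mk, ← map_mul]
  star_add x y := by
    obtain ⟨m, rfl⟩ := mk_surjective x
    obtain ⟨n, rfl⟩ := mk_surjective y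
    simp [star_mk, ← map_add]

instance : StarModule ℂ (Corona E) where
  star_smul c x := by
    obtain ⟨m, rfl⟩ := mk_surjective x
    simp [star_mk, ← map_smul]

instance : NormedRing (Corona E) where
  __ := (inferInstance : NormedAddCommGroup (Corona E))
  __ := (inferInstance : Ring (Corona E))
  norm_mul_le x y := by
    have key : ∀ ε : ℝ, 0 < ε → ‖x * y‖ ≤ (‖x‖ + ε) * (‖y‖ + ε) := by
      intro ε hε
      obtain ⟨m, rfl, hm⟩ := exists_norm_lt x hε
      obtain ⟨n, rfl, hn⟩ := exists_norm_lt y hε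
      rw [← map_mul]
      exact (norm_mk_le _).trans ((norm_mul_le _ _).trans
        (mul_le_mul hm.le hn.le (norm_nonneg _) (by positivity)))
    have hlim : Tendsto (fun ε : ℝ => (‖x‖ + ε) * (‖y‖ + ε)) (𝓝[>] 0) (𝓝 (‖x‖ * ‖y‖)) := by
      have : Continuous (fun ε : ℝ => (‖x‖ + ε) * (‖y‖ + ε)) := by fun_prop
      simpa using (this.tendsto 0).mono_left nhdsWithin_le_nhds
    exact ge_of_tendsto hlim (by filter_upwards [self_mem_nhdsWithin] with ε hε using key ε hε)

instance : NormedAlgebra ℂ (Corona E) where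
  __ := (inferInstance : Algebra ℂ (Corona E))
  norm_smul_le := norm_smul_le

lemma norm_mk_mul_self_le (m : 𝓜(ℂ, E)) : ‖mk E m‖ * ‖mk E m‖ ≤ ‖mk E (star m * m)‖ := by
  let _ := CStarAlgebra.spectralOrder E
  have _ := CStarAlgebra.spectralOrderedRing E
  let _ := CStarAlgebra.spectralOrder 𝓜(ℂ, E)
  have _ := CStarAlgebra.spectralOrderedRing 𝓜(ℂ, E)
  refine le_of_forall_pos_le_add fun ε hε => ?_
  obtain ⟨b, hb, hbn⟩ := exists_norm_lt (mk E (star m * m)) (half_pos hε)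
  obtain ⟨a, ha⟩ := mk_eq_mk.1 hb
  have hu := CStarAlgebra.increasingApproximateUnit E
  have : (CStarAlgebra.approximateUnit E).NeBot := hu.neBot
  have hlim := (hu.tendsto_mul_left a)
  obtain ⟨e, he0, he1, hae⟩ := (hu.eventually_nonneg.and (hu.eventually_norm.and
    (hlim.eventually (Metric.ball_mem_nhds a (half_pos hε))))).exists
  set f : 𝓜(ℂ, E) := (e : 𝓜(ℂ, E)) with hf
  have hf0 : 0 ≤ f := by
    obtain ⟨c, rfl⟩ := CStarAlgebra.nonneg_iff_eq_star_mul_self.1 he0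
    refine CStarAlgebra.nonneg_iff_eq_star_mul_self.2 ⟨(c : 𝓜(ℂ, E)), ?_⟩
    have h1 := map_mul (DoubleCentralizer.coeHom (𝕜 := ℂ) (A := E)) (star c) c
    rw [map_star] at h1
    exact h1
  have hf1 : f ∈ Set.Icc 0 1 :=
    CStarAlgebra.mem_Icc_iff_norm_le_one.2 ⟨hf0, by rw [hf, norm_coe_multiplier]; exact he1⟩
  have hg : 1 - f ∈ Set.Icc 0 1 := Set.sub_mem_Icc_zero_iff_right.2 hf1
  have hgn : ‖1 - f‖ ≤ 1 := (CStarAlgebra.mem_Icc_iff_norm_le_one.1 hg).2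
  have hq : mk E m = mk E (m * (1 - f)) := by
    obtain ⟨c, hc⟩ := (canonicalIdeal E).mul_mem_left m (mem_canonicalIdeal.2 ⟨e, rfl⟩)
    refine mk_eq_mk.2 ⟨c, ?_⟩
    rw [mul_sub, mul_one, sub_sub_cancel]
    exact hc
  have hjf : ‖(a : 𝓜(ℂ, E)) * (1 - f)‖ < ε / 2 := by
    have h1 : (a : 𝓜(ℂ, E)) * (1 - f) = ((a - a * e : E) : 𝓜(ℂ, E)) := by
      have h2 := map_sub (DoubleCentralizer.coeHom (𝕜 := ℂ) (A := E)) a (a * e)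
      rw [map_mul] at h2
      rw [mul_sub, mul_one]
      exact h2.symm
    rw [h1, norm_coe_multiplier, ← dist_eq_norm, dist_comm]
    exact hae
  have hdecomp : star m * m * (1 - f) = b * (1 - f) - (a : 𝓜(ℂ, E)) * (1 - f) := by
    rw [ha]; noncomm_ring
  calc ‖mk E m‖ * ‖mk E m‖ ≤ ‖m * (1 - f)‖ * ‖m * (1 - f)‖ := by
        rw [hq]; exact mul_self_le_mul_self (norm_nonneg _) (norm_mk_le _)
    _ = ‖star (1 - f) * (star m * m * (1 - f))‖ := by
        rw [← CStarRing.norm_star_mul_self, star_mul]; simp only [mul_assoc]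
    _ ≤ ‖star (1 - f)‖ * ‖star m * m * (1 - f)‖ := norm_mul_le _ _
    _ ≤ 1 * ‖star m * m * (1 - f)‖ := by
        rw [norm_star]; exact mul_le_mul_of_nonneg_right hgn (norm_nonneg _)
    _ ≤ ‖b * (1 - f)‖ + ‖(a : 𝓜(ℂ, E)) * (1 - f)‖ := by
        rw [one_mul, hdecomp]; exact norm_sub_le _ _
    _ ≤ ‖b‖ + ε / 2 := by
        refine add_le_add ((norm_mul_le _ _).trans ?_) hjf.le
        exact mul_le_of_le_one_right (norm_nonneg _) hgn
    _ ≤ ‖mk E (star m * m)‖ + ε := by linarith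

instance : CStarRing (Corona E) where
  norm_mul_self_le x := by
    obtain ⟨m, rfl⟩ := mk_surjective x
    rw [star_mk, ← map_mul]
    exact norm_mk_mul_self_le m

instance : CStarAlgebra (Corona E) where

end Corona

end Corona

/-! ### Hypotheses on C⋆-algebras -/

/-- `E` is nonunital: it has no unit element. -/
def IsNonunital (E : Type*) [NonUnitalCStarAlgebra E] : Prop :=
  ¬ ∃ e : E, ∀ a : E, e * a = a ∧ a * e = a

/-- `E` is σ-unital: it has a sequential approximate unit consisting of positive contractions
(positive elements of a C⋆-algebra are those of the form `star b * b`). -/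
def IsSigmaUnital (E : Type*) [NonUnitalCStarAlgebra E] : Prop :=
  ∃ e : ℕ → E, (∀ n, (∃ b : E, e n = star b * b) ∧ ‖e n‖ ≤ 1) ∧
    ∀ a : E, Tendsto (fun n => e n * a) atTop (𝓝 a) ∧ Tendsto (fun n => a * e n) atTop (𝓝 a)

/-! ### Extensions and their equivalences -/

section Extension

variable {D E : Type*} [NonUnitalCStarAlgebra D] [NonUnitalCStarAlgebra E]

/-- An extension of `E` by `D`, identified with its Busby invariant: a (not necessarily unital or
injective) `*`-homomorphism `D → C(E)`. -/
abbrev Extension (D E : Type*) [NonUnitalCStarAlgebra D] [NonUnitalCStarAlgebra E] : Type _ :=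
  D →⋆ₙₐ[ℂ] Corona E

/-- There is a norm-continuous path `(u_t)`, `t ∈ [1, ∞)`, of unitaries of `C(E)` with
`u_t φ(a) u_t* → ψ(a)` in norm for every `a`. -/
def AsymptoticallyUnitarilyEquivalent (φ ψ : Extension D E) : Prop :=
  ∃ u : Set.Ici (1 : ℝ) → unitary (Corona E), Continuous u ∧
    ∀ a : D, Tendsto (fun t => (u t : Corona E) * φ a * star (u t : Corona E)) atTop (𝓝 (ψ a))

/-- There is a unitary `w` of `C(E)` with `w φ(a) w* = ψ(a)` for every `a`. -/
def WeaklyUnitarilyEquivalent (φ ψ : Extension D E) : Prop :=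
  ∃ w : unitary (Corona E), ∀ a : D, (w : Corona E) * φ a * star (w : Corona E) = ψ a

end Extension

end CStarExt

end

/-!
Sampling the path gives unitaries `uₙ` of the corona whose consecutive distances tend to `0`. It is
enough to lift `uₙ u₀⋆` to unitary multipliers `Vₙ` that converge strictly to a unitary `W` and
such that `Vₙ X Vₙ⋆` converges in norm for each of countably many multipliers `X` chosen in
advance, lifts of `u₀ φ(d) u₀⋆` with `d` in a dense sequence: then the image of `W`, times `u₀`,
conjugates `φ` into `ψ`.

One takes `Vₙ₊₁ = g Vₙ` with `g` a unitary lift of `v = uₙ₊₁ uₙ⋆`. As `v` is close to `1`, it is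
the Cayley transform of a small skew-adjoint element; if `a` is a lift of the latter, `g` is the
Cayley transform of `s a s`, where `s` is `1` modulo `E`, almost annihilates any given finite part
of `E` and almost commutes with any given finite set of multipliers. The first property of `s`
gives `g` the right image, the second makes `Vₙ` strictly Cauchy, and the third controls the
conjugates: with `c⋆c + s² = 1`, `T = Vₙ X Vₙ⋆` and an earlier conjugate `T'`, the element
`g T g⋆ - T'` is, up to a small error, `c⋆(T - T')c + s(b + w)s`, where `b` is a multiplier of
almost minimal norm with the same image as `T - T'` in the corona and `w` is of the order of
`‖v - 1‖ ‖X‖`. Its norm is at most `max ‖T - T'‖ ‖b + w‖`: since this is a maximum and not a sum,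
only the small errors accumulate along the sequence, and these are summable.
-/

namespace CStarExt

section Compression

variable {A : Type*} [CStarAlgebra A]

lemma norm_le_of_star_mul_self_le [PartialOrder A] [StarOrderedRing A] {a : A} {m : ℝ}
    (hm : 0 ≤ m) (h : star a * a ≤ algebraMap ℝ A (m ^ 2)) : ‖a‖ ≤ m := by
  have hsq : ‖a‖ ^ 2 ≤ m ^ 2 := by
    rw [sq, ← CStarRing.norm_star_mul_self]
    exact (CStarAlgebra.norm_le_iff_le_algebraMap _ (sq_nonneg m) (star_mul_self_nonneg a)).2 h
  exact (pow_le_pow_iff_left₀ (norm_nonneg a) hm two_ne_zero).1 hsq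

lemma norm_conj_add_conj_le {c s : A} (hcs : star c * c + star s * s = 1) (x b : A) :
    ‖star c * x * c + star s * b * s‖ ≤ max ‖x‖ ‖b‖ := by
  let _ := CStarAlgebra.spectralOrder A
  have _ := CStarAlgebra.spectralOrderedRing A
  set m := max ‖x‖ ‖b‖
  set T := star c * x * c + star s * b * s with hT
  have conj_le {a : A} (ha : ‖a‖ ≤ m) (d : A) :
      star d * (star a * a) * d ≤ star d * algebraMap ℝ A (m ^ 2) * d :=
    star_left_conjugate_le_conjugate (CStarAlgebra.star_mul_le_algebraMap_norm_sq.trans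
      (algebraMap_mono A (pow_le_pow_left₀ (norm_nonneg a) ha 2))) d
  have hscalar : star c * algebraMap ℝ A (m ^ 2) * c + star s * algebraMap ℝ A (m ^ 2) * s
      = algebraMap ℝ A (m ^ 2) := by
    rw [← Algebra.commutes, ← Algebra.commutes, mul_assoc, mul_assoc, ← mul_add, hcs, mul_one]
  have hsos : star c * (star x * x) * c + star s * (star b * b) * s - star T * T
      = star (x * c - c * T) * (x * c - c * T) + star (b * s - s * T) * (b * s - s * T) := by
    have hT' : star T = star c * star x * c + star s * star b * s := by
      simp only [hT, star_add, star_mul, star_star, mul_assoc]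
    simp only [star_sub, star_mul]
    linear_combination (norm := noncomm_ring) -star T * hT - hT' * T - star T * hcs * T
  refine norm_le_of_star_mul_self_le (le_max_of_le_left (norm_nonneg x)) ?_
  calc star T * T
      ≤ star c * (star x * x) * c + star s * (star b * b) * s := by
        rw [← sub_nonneg, hsos]
        exact add_nonneg (star_mul_self_nonneg _) (star_mul_self_nonneg _)
    _ ≤ algebraMap ℝ A (m ^ 2) :=
        (add_le_add (conj_le (le_max_left _ _) c) (conj_le (le_max_right _ _) s)).trans_eq hscalar

end Compression

section Cayley

/-- The resolvent `(1 - z)⁻¹` out of which the Cayley transform of a skew-adjoint element is built.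
It is `0` when `1 - z` is not invertible. -/
noncomputable def cayleyResolvent {A : Type*} [Ring A] (z : A) : A := Ring.inverse (1 - z)

/-- The Cayley transform `(1 + z)(1 - z)⁻¹` of a skew-adjoint element `z`, encoded as
`2(1 - z)⁻¹ - 1`. Unlike the exponential, it is rational in `z`. -/
noncomputable def cayley {A : Type*} [Ring A] (z : A) : A := 2 * cayleyResolvent z - 1

variable {A : Type*} [CStarAlgebra A] {z : A}

lemma isUnit_one_sub_of_skewAdjoint (hz : z ∈ skewAdjoint A) : IsUnit (1 - z) := by
  have hsa : IsSelfAdjoint (Complex.I • z) := by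
    simp [isSelfAdjoint_iff, skewAdjoint.mem_iff.1 hz]
  have hI : Complex.I ∉ spectrum ℂ (Complex.I • z) := fun h => by
    simpa using congrArg Complex.im (hsa.mem_spectrum_eq_re h)
  have hunit : IsUnit (Complex.I • (1 - z)) := by
    simpa [spectrum.notMem_iff, Algebra.algebraMap_eq_smul_one, smul_sub] using hI
  exact (isUnit_smul_iff (Units.mk0 Complex.I Complex.I_ne_zero) (1 - z)).1 hunit

lemma cayleyResolvent_mul_one_sub (hz : z ∈ skewAdjoint A) : cayleyResolvent z * (1 - z) = 1 :=
  Ring.inverse_mul_cancel _ (isUnit_one_sub_of_skewAdjoint hz)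

lemma one_sub_mul_cayleyResolvent (hz : z ∈ skewAdjoint A) : (1 - z) * cayleyResolvent z = 1 :=
  Ring.mul_inverse_cancel _ (isUnit_one_sub_of_skewAdjoint hz)

lemma star_cayleyResolvent {A : Type*} [Ring A] [StarRing A] (z : A) :
    star (cayleyResolvent z) = cayleyResolvent (star z) := by
  rw [cayleyResolvent, ← Ring.inverse_star, star_sub, star_one, cayleyResolvent]

lemma one_add_mul_cayleyResolvent_neg (hz : z ∈ skewAdjoint A) :
    (1 + z) * cayleyResolvent (-z) = 1 := by
  simpa using one_sub_mul_cayleyResolvent (neg_mem hz)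

lemma cayleyResolvent_neg_mul_one_add (hz : z ∈ skewAdjoint A) :
    cayleyResolvent (-z) * (1 + z) = 1 := by
  simpa using cayleyResolvent_mul_one_sub (neg_mem hz)

lemma cayleyResolvent_add_neg (hz : z ∈ skewAdjoint A) :
    cayleyResolvent z + cayleyResolvent (-z) = 2 * (cayleyResolvent z * cayleyResolvent (-z)) := by
  linear_combination (norm := noncomm_ring)
    -cayleyResolvent z * one_add_mul_cayleyResolvent_neg hz
      - cayleyResolvent_mul_one_sub hz * cayleyResolvent (-z)

lemma star_cayley (hz : z ∈ skewAdjoint A) : star (cayley z) = cayley (-z) := by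
  rw [cayley, cayley, star_sub, star_mul, star_cayleyResolvent, skewAdjoint.mem_iff.1 hz, star_one,
    star_ofNat, two_mul, mul_two]

lemma cayley_mul_cayley_neg (hz : z ∈ skewAdjoint A) : cayley z * cayley (-z) = 1 := by
  simp only [cayley]
  linear_combination (norm := noncomm_ring) -2 * cayleyResolvent_add_neg hz

lemma cayley_mem_unitary (hz : z ∈ skewAdjoint A) : cayley z ∈ unitary A := by
  rw [Unitary.mem_iff, star_cayley hz]
  exact ⟨by simpa using cayley_mul_cayley_neg (neg_mem hz), cayley_mul_cayley_neg hz⟩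

lemma norm_cayleyResolvent_mul_le (hz : z ∈ skewAdjoint A) (x : A) :
    ‖cayleyResolvent z * x‖ ≤ ‖x‖ := by
  have hadd : (2 : ℝ) • (cayleyResolvent z * x) = x + cayley z * x := by
    rw [two_smul, cayley]
    noncomm_ring
  have hnorm : 2 * ‖cayleyResolvent z * x‖ ≤ ‖x‖ + ‖x‖ := by
    calc 2 * ‖cayleyResolvent z * x‖ = ‖x + cayley z * x‖ := by rw [← hadd, norm_smul]; norm_num
      _ ≤ ‖x‖ + ‖cayley z * x‖ := norm_add_le _ _
      _ = ‖x‖ + ‖x‖ := by rw [CStarRing.norm_mem_unitary_mul x (cayley_mem_unitary hz)]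
  linarith

lemma norm_mul_cayleyResolvent_le (hz : z ∈ skewAdjoint A) (x : A) :
    ‖x * cayleyResolvent z‖ ≤ ‖x‖ := by
  rw [← norm_star, star_mul, star_cayleyResolvent, skewAdjoint.mem_iff.1 hz, ← norm_star x]
  exact norm_cayleyResolvent_mul_le (neg_mem hz) (star x)

lemma cayley_sub_one (hz : z ∈ skewAdjoint A) : cayley z - 1 = 2 * (cayleyResolvent z * z) := by
  rw [cayley]
  linear_combination (norm := noncomm_ring) 2 * cayleyResolvent_mul_one_sub hz

lemma norm_cayley_sub_one_mul_le (hz : z ∈ skewAdjoint A) (x : A) :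
    ‖(cayley z - 1) * x‖ ≤ 2 * ‖z * x‖ := by
  rw [cayley_sub_one hz, mul_assoc, mul_assoc, two_mul, two_mul]
  exact norm_add_le_of_le (norm_cayleyResolvent_mul_le hz _) (norm_cayleyResolvent_mul_le hz _)

lemma cayleyResolvent_commutator (hz : z ∈ skewAdjoint A) (x : A) :
    cayleyResolvent z * x - x * cayleyResolvent z
      = cayleyResolvent z * (z * x - x * z) * cayleyResolvent z := by
  linear_combination (norm := noncomm_ring)
    cayleyResolvent_mul_one_sub hz * x * cayleyResolvent z
      - cayleyResolvent z * x * one_sub_mul_cayleyResolvent hz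

lemma norm_cayleyResolvent_commutator_le (hz : z ∈ skewAdjoint A) (x : A) :
    ‖cayleyResolvent z * x - x * cayleyResolvent z‖ ≤ ‖z * x - x * z‖ := by
  rw [cayleyResolvent_commutator hz]
  exact (norm_mul_cayleyResolvent_le hz _).trans (norm_cayleyResolvent_mul_le hz _)

lemma cayley_conj_sub (hz : z ∈ skewAdjoint A) (t : A) :
    cayley z * t * star (cayley z) - t
      = 2 * (cayleyResolvent z * (z * t - t * z) * cayleyResolvent (-z)) := by
  rw [star_cayley hz, cayley, cayley]
  linear_combination (norm := noncomm_ring)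
    2 * cayleyResolvent_mul_one_sub hz * t * cayleyResolvent (-z)
      + 2 * cayleyResolvent z * t * one_add_mul_cayleyResolvent_neg hz

lemma one_sub_mul_one_add_cayley (hz : z ∈ skewAdjoint A) : (1 - z) * (1 + cayley z) = 2 := by
  rw [cayley, ← one_add_one_eq_two]
  linear_combination (norm := noncomm_ring) 2 * one_sub_mul_cayleyResolvent hz

lemma cayley_eq_of_mul_eq {v : A} (hz : z ∈ skewAdjoint A) (h : (1 - z) * (1 + v) = 2) :
    cayley z = v := by
  rw [cayley]
  linear_combination (norm := noncomm_ring)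
    cayleyResolvent_mul_one_sub hz * (1 + v) - cayleyResolvent z * h

lemma map_cayley {B : Type*} [CStarAlgebra B] (f : A →+* B) (hz : z ∈ skewAdjoint A)
    (hfz : f z ∈ skewAdjoint B) : f (cayley z) = cayley (f z) := by
  refine (cayley_eq_of_mul_eq hfz ?_).symm
  simpa [map_ofNat] using congrArg f (one_sub_mul_one_add_cayley hz)

lemma isUnit_one_add_of_norm_sub_one_le {A : Type*} [NormedRing A] [NormedAlgebra ℝ A]
    [CompleteSpace A] {v : A} (h1 : ‖v - 1‖ ≤ 1) : IsUnit (1 + v) := by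
  have hunit : IsUnit (1 - (2⁻¹ : ℝ) • (1 - v)) := isUnit_one_sub_of_norm_lt_one <| by
    rw [norm_smul, norm_sub_rev, norm_inv, Real.norm_ofNat]
    linarith
  convert (isUnit_smul_iff (Units.mk0 (2 : ℝ) two_ne_zero) _).2 hunit using 1
  rw [Units.smul_mk0]
  module

lemma exists_cayley_eq_of_norm_sub_one_le {v : A} (hv : v ∈ unitary A) (h1 : ‖v - 1‖ ≤ 1) :
    ∃ z ∈ skewAdjoint A, ‖z‖ ≤ ‖v - 1‖ ∧ cayley z = v := by
  obtain ⟨⟨_, q, hq, hq'⟩, rfl⟩ := isUnit_one_add_of_norm_sub_one_le h1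
  obtain ⟨hv, hv'⟩ := Unitary.mem_iff.1 hv
  have hstar : star q = q * v := by
    have hq_star : star q * (1 + star v) = 1 := by simpa using congrArg star hq
    linear_combination (norm := noncomm_ring)
      hq_star * v * q - star q * hq - star q * hv * q + hq - hq'
  have hz : (v - 1) * q ∈ skewAdjoint A := by
    rw [skewAdjoint.mem_iff, star_mul, star_sub, star_one, hstar]
    linear_combination (norm := noncomm_ring) q * hv' + hq - hq'
  have hmul : (v - 1) * q * (1 + v) = v - 1 := by rw [mul_assoc, hq', mul_one]
  refine ⟨(v - 1) * q, hz, ?_, cayley_eq_of_mul_eq hz ?_⟩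
  · have htwo : (2 : ℝ) • ((v - 1) * q) = (v - 1) - (v - 1) * q * (v - 1) := by
      rw [two_smul]
      linear_combination (norm := noncomm_ring) hmul
    have hnorm : 2 * ‖(v - 1) * q‖ ≤ ‖v - 1‖ + ‖(v - 1) * q‖ * 1 := by
      rw [← Real.norm_ofNat, ← norm_smul, htwo]
      exact norm_sub_le_of_le le_rfl (norm_mul_le_of_le le_rfl h1)
    linarith
  · rw [← one_add_one_eq_two]
    linear_combination (norm := noncomm_ring) -hmul

lemma norm_cayleyResolvent_neg_commutator_le (hz : z ∈ skewAdjoint A) (x : A) :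
    ‖cayleyResolvent (-z) * x - x * cayleyResolvent (-z)‖ ≤ ‖z * x - x * z‖ := by
  refine (norm_cayleyResolvent_commutator_le (neg_mem hz) x).trans_eq ?_
  rw [neg_mul, mul_neg, neg_sub_neg, norm_sub_rev]

/-- The self-adjoint part of `cayley z`, for skew-adjoint `z`. -/
noncomputable def cayleyRe {A : Type*} [Ring A] (z : A) : A :=
  cayleyResolvent z + cayleyResolvent (-z) - 1

/-- The skew-adjoint part of `cayley z`, for skew-adjoint `z`. -/
noncomputable def cayleySkew {A : Type*} [Ring A] (z : A) : A :=
  cayleyResolvent z - cayleyResolvent (-z)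

lemma isSelfAdjoint_cayleyRe (hz : z ∈ skewAdjoint A) : IsSelfAdjoint (cayleyRe z) := by
  rw [isSelfAdjoint_iff, cayleyRe, star_sub, star_add, star_cayleyResolvent, star_cayleyResolvent,
    star_neg, skewAdjoint.mem_iff.1 hz, neg_neg, star_one, add_comm]

lemma star_cayleySkew (hz : z ∈ skewAdjoint A) : star (cayleySkew z) = -cayleySkew z := by
  rw [cayleySkew, star_sub, star_cayleyResolvent, star_cayleyResolvent, star_neg,
    skewAdjoint.mem_iff.1 hz, neg_neg, neg_sub]

lemma star_cayleySkew_mul_add_star_cayleyRe_mul (hz : z ∈ skewAdjoint A) :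
    star (cayleySkew z) * cayleySkew z + star (cayleyRe z) * cayleyRe z = 1 := by
  have hswap : cayleyResolvent (-z) + cayleyResolvent z
      = 2 * (cayleyResolvent (-z) * cayleyResolvent z) := by
    simpa using cayleyResolvent_add_neg (neg_mem hz)
  rw [(isSelfAdjoint_cayleyRe hz).star_eq, star_cayleySkew hz, cayleyRe, cayleySkew]
  linear_combination (norm := noncomm_ring) -cayleyResolvent_add_neg hz - hswap

lemma norm_cayleyRe_commutator_le (hz : z ∈ skewAdjoint A) (x : A) :
    ‖cayleyRe z * x - x * cayleyRe z‖ ≤ 2 * ‖z * x - x * z‖ := by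
  have hsum : cayleyRe z * x - x * cayleyRe z
      = (cayleyResolvent z * x - x * cayleyResolvent z)
        + (cayleyResolvent (-z) * x - x * cayleyResolvent (-z)) := by
    rw [cayleyRe]
    noncomm_ring
  rw [hsum, two_mul]
  exact norm_add_le_of_le (norm_cayleyResolvent_commutator_le hz x)
    (norm_cayleyResolvent_neg_commutator_le hz x)

lemma norm_cayleySkew_commutator_le (hz : z ∈ skewAdjoint A) (x : A) :
    ‖cayleySkew z * x - x * cayleySkew z‖ ≤ 2 * ‖z * x - x * z‖ := by
  have hsub : cayleySkew z * x - x * cayleySkew z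
      = (cayleyResolvent z * x - x * cayleyResolvent z)
        - (cayleyResolvent (-z) * x - x * cayleyResolvent (-z)) := by
    rw [cayleySkew]
    noncomm_ring
  rw [hsub, two_mul]
  exact norm_sub_le_of_le (norm_cayleyResolvent_commutator_le hz x)
    (norm_cayleyResolvent_neg_commutator_le hz x)

lemma cayleyRe_eq_mul (hz : z ∈ skewAdjoint A) :
    cayleyRe z = cayleyResolvent z * (cayleyResolvent (-z) * (1 + z * z)) := by
  rw [cayleyRe]
  linear_combination (norm := noncomm_ring)
    cayleyResolvent_add_neg hz
      + cayleyResolvent z * cayleyResolvent_neg_mul_one_add hz * (1 - z)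
      + cayleyResolvent_mul_one_sub hz

lemma one_sub_cayleyRe (hz : z ∈ skewAdjoint A) : 1 - cayleyRe z = -cayleySkew z * z := by
  rw [cayleyRe, cayleySkew]
  linear_combination (norm := noncomm_ring)
    -cayleyResolvent_mul_one_sub hz - cayleyResolvent_neg_mul_one_add hz

end Cayley

section Quasicentral

variable {A : Type*} [CStarAlgebra A] {J : Ideal A}

/-- The ideal `J` has an approximate unit of self-adjoint contractions. Finite subsets are used
instead of nets, so that the elements of `J` can be chosen one after the other. -/
def HasApproximateUnit (J : Ideal A) : Prop :=
  ∀ F : Set A, F.Finite → F ⊆ J → ∀ ε : ℝ, 0 < ε →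
    ∃ e ∈ J, IsSelfAdjoint e ∧ ‖e‖ ≤ 1 ∧ ∀ a ∈ F, ‖a - e * a‖ ≤ ε ∧ ‖a - a * e‖ ≤ ε

lemma norm_sum_sq_le {A ι : Type*} [NonUnitalNormedRing A] [StarRing A] [CStarRing A]
    {s : Finset ι} {y : ι → A} {K δ : ℝ} (hδ : 0 ≤ δ)
    (hK : ∀ i ∈ s, ‖y i‖ ^ 2 ≤ K) (hy : ∀ i ∈ s, ∀ k ∈ s, i ≠ k → ‖y i * star (y k)‖ ≤ δ) :
    ‖∑ i ∈ s, y i‖ ^ 2 ≤ s.card * K + s.card ^ 2 * δ := by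
  classical
  have hterm : ∀ i ∈ s, ∀ k ∈ s, ‖y i * star (y k)‖ ≤ (if i = k then K else 0) + δ := by
    intro i hi k hk
    split_ifs with h
    · subst h
      rw [CStarRing.norm_self_mul_star, ← sq]
      linarith [hK i hi]
    · simpa using hy i hi k hk h
  calc ‖∑ i ∈ s, y i‖ ^ 2 = ‖∑ i ∈ s, ∑ k ∈ s, y i * star (y k)‖ := by
        rw [sq, ← CStarRing.norm_self_mul_star, star_sum, Finset.sum_mul_sum]
    _ ≤ ∑ i ∈ s, ∑ k ∈ s, ((if i = k then K else 0) + δ) :=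
        norm_sum_le_of_le s fun i hi => norm_sum_le_of_le s fun k hk => hterm i hi k hk
    _ = s.card * K + s.card ^ 2 * δ := by
        simp only [Finset.sum_add_distrib, Finset.sum_ite_eq, Finset.sum_const, nsmul_eq_mul,
          Finset.sum_ite_mem, Finset.inter_self]
        ring

lemma HasApproximateUnit.exists_seq [J.IsTwoSided] (hJ : HasApproximateUnit J) {F G : Set A}
    (hF : F.Finite) (hFJ : F ⊆ J) (hG : G.Finite) {δ : ℝ} (hδ : 0 < δ) :
    ∃ e : ℕ → A,
      (∀ n, e n ∈ J ∧ IsSelfAdjoint (e n) ∧ ‖e n‖ ≤ 1 ∧ ∀ a ∈ F, ‖a - e n * a‖ ≤ δ) ∧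
      ∀ m n, m < n → ∀ x ∈ G,
        ‖e m * x * (1 - e m) - e m * x * (1 - e m) * e n‖ ≤ δ := by
  refine exists_seq_of_forall_finset_exists
    (fun e => e ∈ J ∧ IsSelfAdjoint e ∧ ‖e‖ ≤ 1 ∧ ∀ a ∈ F, ‖a - e * a‖ ≤ δ)
    (fun d e => ∀ x ∈ G, ‖d * x * (1 - d) - d * x * (1 - d) * e‖ ≤ δ) fun s hs => ?_
  have hsubset : F ∪ Set.image2 (fun d x => d * x * (1 - d)) s G ⊆ J := by
    refine Set.union_subset hFJ (Set.image2_subset_iff.2 fun d hd x _ => ?_)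
    exact J.mul_mem_right _ (J.mul_mem_right _ (hs d hd).1)
  obtain ⟨e, heJ, hesa, henorm, he⟩ :=
    hJ _ (hF.union (s.finite_toSet.image2 _ hG)) hsubset δ hδ
  exact ⟨e, ⟨heJ, hesa, henorm, fun a ha => (he a (.inl ha)).1⟩,
    fun d hd x hx => (he _ (.inr (Set.mem_image2_of_mem hd hx))).2⟩

lemma norm_sum_corner_le {e : ℕ → A} (he : ∀ n, IsSelfAdjoint (e n)) (he1 : ∀ n, ‖e n‖ ≤ 1) {x : A}
    {C δ : ℝ} (hC : 0 < C) (hx : ‖x‖ ≤ C) (hδ : 0 < δ)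
    (horth : ∀ m n, m < n → ‖e m * x * (1 - e m) - e m * x * (1 - e m) * e n‖ ≤ δ / C) (m : ℕ) :
    ‖∑ i ∈ Finset.range m, e i * x * (1 - e i)‖ ^ 2 ≤ m * (2 * C) ^ 2 + m ^ 2 * δ := by
  have hone_sub (n) (a : A) : ‖a * (1 - e n)‖ ≤ 2 * ‖a‖ := by
    rw [mul_sub, mul_one, two_mul]
    exact norm_sub_le_of_le le_rfl
      ((norm_mul_le_of_le le_rfl (he1 n)).trans_eq (mul_one _))
  have hnorm (n) : ‖e n * x‖ ≤ C :=
    (norm_mul_le_of_le (he1 n) hx).trans_eq (one_mul C)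
  have hlt {i k : ℕ} (hik : i < k) :
      ‖e i * x * (1 - e i) * star (e k * x * (1 - e k))‖ ≤ δ := by
    have hfac : e i * x * (1 - e i) * star (e k * x * (1 - e k))
        = (e i * x * (1 - e i) - e i * x * (1 - e i) * e k) * star (e k * x) := by
      simp only [star_mul, star_sub, star_one, (he k).star_eq]
      noncomm_ring
    rw [hfac]
    refine (norm_mul_le_of_le (horth i k hik) ((norm_star _).trans_le (hnorm k))).trans_eq ?_
    exact div_mul_cancel₀ δ hC.ne'
  refine (norm_sum_sq_le (K := (2 * C) ^ 2) hδ.le (fun i _ => ?_) fun i _ k _ hik => ?_).trans_eq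
    (by rw [Finset.card_range])
  · have := (hone_sub i (e i * x)).trans (mul_le_mul_of_nonneg_left (hnorm i) zero_le_two)
    gcongr
  · rcases hik.lt_or_gt with h | h
    · exact hlt h
    · rw [← norm_star, star_mul, star_star]
      exact hlt h

lemma norm_sum_commutator_le {e : ℕ → A} (he : ∀ n, IsSelfAdjoint (e n)) {x : A} {ε : ℝ}
    {m : ℕ} (hx : ‖∑ i ∈ Finset.range m, e i * x * (1 - e i)‖ ≤ m * (ε / 2))
    (hx' : ‖∑ i ∈ Finset.range m, e i * star x * (1 - e i)‖ ≤ m * (ε / 2)) :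
    ‖∑ i ∈ Finset.range m, (e i * x - x * e i)‖ ≤ m * ε := by
  have hcomm : ∑ i ∈ Finset.range m, (e i * x - x * e i)
      = ∑ i ∈ Finset.range m, e i * x * (1 - e i)
        - star (∑ i ∈ Finset.range m, e i * star x * (1 - e i)) := by
    rw [star_sum, ← Finset.sum_sub_distrib]
    refine Finset.sum_congr rfl fun i _ => ?_
    simp only [star_mul, star_sub, star_star, star_one, (he i).star_eq]
    noncomm_ring
  rw [hcomm]
  refine (norm_sub_le_of_le hx ((norm_star _).trans_le hx')).trans_eq (by ring)

lemma exists_nat_average_bound (C : ℝ) {ε : ℝ} (hε : 0 < ε) :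
    ∃ m : ℕ, 0 < m ∧ m * (2 * C) ^ 2 + m ^ 2 * (ε ^ 2 / 8) ≤ (m * (ε / 2)) ^ 2 := by
  obtain ⟨m, hm⟩ := exists_nat_ge (32 * C ^ 2 / ε ^ 2)
  rw [div_le_iff₀ (by positivity)] at hm
  refine ⟨m + 1, m.succ_pos, ?_⟩
  push_cast
  nlinarith [sq_nonneg ε, mul_nonneg (m.cast_nonneg (α := ℝ)) (sq_nonneg ε)]

/-- The corners `eᵢ x (1 - eᵢ)` of a sufficiently sparse approximate unit are almost orthogonal,
so their sum grows only like the square root of the number of terms. -/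
lemma HasApproximateUnit.exists_seq_norm_sum_corner_le [J.IsTwoSided] (hJ : HasApproximateUnit J)
    {F G : Set A} (hF : F.Finite) (hFJ : F ⊆ J) (hG : G.Finite) {ε : ℝ} (hε : 0 < ε) :
    ∃ (e : ℕ → A) (m : ℕ), 0 < m ∧
      (∀ n, e n ∈ J ∧ IsSelfAdjoint (e n) ∧ ‖e n‖ ≤ 1 ∧ ∀ a ∈ F, ‖a - e n * a‖ ≤ ε) ∧
      ∀ x ∈ G, ‖∑ i ∈ Finset.range m, e i * x * (1 - e i)‖ ≤ m * (ε / 2) := by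
  obtain ⟨C, hC, hGC⟩ := hG.isBounded.exists_pos_norm_le
  obtain ⟨m, hm, hbound⟩ := exists_nat_average_bound C hε
  obtain ⟨e, he, horth⟩ := hJ.exists_seq hF hFJ hG
    (lt_min hε (show 0 < ε ^ 2 / 8 / C by positivity))
  refine ⟨e, m, hm, fun n => ?_, fun x hx => ?_⟩
  · obtain ⟨heJ, hsa, he1, hunit⟩ := he n
    exact ⟨heJ, hsa, he1, fun a ha => (hunit a ha).trans (min_le_left _ _)⟩
  · refine (pow_le_pow_iff_left₀ (norm_nonneg _) (by positivity) two_ne_zero).1 (le_trans ?_ hbound)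
    exact norm_sum_corner_le (fun n => (he n).2.1) (fun n => (he n).2.2.1) hC (hGC x hx)
      (by positivity) (fun i k hik => (horth i k hik x hx).trans (min_le_right _ _)) m

lemma HasApproximateUnit.exists_quasicentral [J.IsTwoSided] (hJ : HasApproximateUnit J) {F : Set A}
    (hF : F.Finite) {ε : ℝ} (hε : 0 < ε) :
    ∃ e ∈ J, IsSelfAdjoint e ∧ ‖e‖ ≤ 1 ∧ (∀ x ∈ F, ‖e * x - x * e‖ ≤ ε) ∧
      ∀ a ∈ F, a ∈ J → ‖a - e * a‖ ≤ ε := by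
  obtain ⟨e, m, hm, he, hcorner⟩ := hJ.exists_seq_norm_sum_corner_le (hF.inter_of_left J)
    Set.inter_subset_right (hF.union (hF.image star)) hε
  have havg {a : A} {c : ℝ} (ha : ‖a‖ ≤ m * c) : ‖(m : ℝ)⁻¹ • a‖ ≤ c := by
    rw [norm_smul, norm_inv, RCLike.norm_natCast]
    exact (inv_mul_le_iff₀ (by exact_mod_cast hm)).2 ha
  have hsum {f : ℕ → A} {c : ℝ} (hf : ∀ i, ‖f i‖ ≤ c) :
      ‖∑ i ∈ Finset.range m, f i‖ ≤ m * c := by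
    simpa using norm_sum_le_of_le (Finset.range m) fun i _ => hf i
  refine ⟨(m : ℝ)⁻¹ • ∑ i ∈ Finset.range m, e i, ?_, ?_, ?_, ?_, ?_⟩
  · exact Submodule.smul_of_tower_mem J _ (sum_mem fun i _ => (he i).1)
  · exact (IsSelfAdjoint.all _).smul (isSelfAdjoint_sum _ fun i _ => (he i).2.1)
  · exact havg (hsum fun i => (he i).2.2.1)
  · intro x hx
    rw [smul_mul_assoc, mul_smul_comm, ← smul_sub, Finset.sum_mul, Finset.mul_sum,
      ← Finset.sum_sub_distrib]
    exact havg (norm_sum_commutator_le (fun n => (he n).2.1) (hcorner x (.inl hx))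
      (hcorner _ (.inr (Set.mem_image_of_mem star hx))))
  · intro a haF haJ
    have hsub : a - ((m : ℝ)⁻¹ • ∑ i ∈ Finset.range m, e i) * a
        = (m : ℝ)⁻¹ • ∑ i ∈ Finset.range m, (a - e i * a) := by
      rw [Finset.sum_sub_distrib, Finset.sum_const, Finset.card_range, smul_sub,
        ← Nat.cast_smul_eq_nsmul ℝ, inv_smul_smul₀ (by exact_mod_cast hm.ne'), smul_mul_assoc,
        Finset.sum_mul]
    rw [hsub]
    exact havg (hsum fun i => (he i).2.2.2 a ⟨haF, haJ⟩)

end Quasicentral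

section NormedRing

variable {A : Type*} [SeminormedRing A]

lemma norm_mul_le_of_norm_le_one_left {a x : A} (ha : ‖a‖ ≤ 1) {C : ℝ} (hx : ‖x‖ ≤ C) :
    ‖a * x‖ ≤ C :=
  (norm_mul_le_of_le ha hx).trans_eq (one_mul C)

lemma norm_mul_le_of_norm_le_one_right {a x : A} (ha : ‖a‖ ≤ 1) {C : ℝ} (hx : ‖x‖ ≤ C) :
    ‖x * a‖ ≤ C :=
  (norm_mul_le_of_le hx ha).trans_eq (mul_one C)

lemma norm_mul_sub_mul_le (a t : A) : ‖a * t - t * a‖ ≤ 2 * (‖a‖ * ‖t‖) :=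
  (norm_sub_le_of_le (norm_mul_le a t) (norm_mul_le t a)).trans_eq (by ring)

lemma norm_one_sub_mul_self_mul_le {e : A} (he : ‖e‖ ≤ 1) {a : A} {C : ℝ} (ha : ‖a - e * a‖ ≤ C) :
    ‖(1 - e * e) * a‖ ≤ 2 * C := by
  have hfac : (1 - e * e) * a = (a - e * a) + e * (a - e * a) := by noncomm_ring
  rw [hfac, two_mul]
  exact norm_add_le_of_le ha (norm_mul_le_of_norm_le_one_left he ha)

lemma norm_commutator_conj_sub_le {s a t : A} {ε : ℝ} (hs : ‖s‖ ≤ 1) (hst : ‖s * t - t * s‖ ≤ ε) :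
    ‖(s * a * s * t - t * (s * a * s)) - s * (a * t - t * a) * s‖ ≤ 2 * ‖a‖ * ε := by
  have hdecomp : (s * a * s * t - t * (s * a * s)) - s * (a * t - t * a) * s
      = s * (a * (s * t - t * s)) + (s * t - t * s) * a * s := by noncomm_ring
  rw [hdecomp]
  refine (norm_add_le_of_le
    (norm_mul_le_of_norm_le_one_left hs (norm_mul_le_of_le le_rfl hst))
    (norm_mul_le_of_norm_le_one_right hs (norm_mul_le_of_le hst le_rfl))).trans_eq (by ring)

end NormedRing

section Cutoff

variable {A : Type*} [CStarAlgebra A] {J : Ideal A} {F : Set A} {ε : ℝ} {s c : A}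

/-- A cut-off for `J`: `s` equals `1` modulo `J`, almost commutes with `F` and almost annihilates
`F ∩ J`. The complementary element `c` also almost commutes with `F` and, as `|c|² + s² = 1`, the
pair `(s, c)` behaves like the cosine and sine of an operator angle. -/
structure IsQuasicentralCutoff (J : Ideal A) (F : Set A) (ε : ℝ) (s c : A) : Prop where
  isSelfAdjoint : IsSelfAdjoint s
  star_mul_add_star_mul : star c * c + star s * s = 1
  one_sub_mem : 1 - s ∈ J
  norm_commutator_le : ∀ x ∈ F, ‖s * x - x * s‖ ≤ ε
  norm_compl_commutator_le : ∀ x ∈ F, ‖c * x - x * c‖ ≤ ε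
  norm_mul_le_of_mem : ∀ a ∈ F, a ∈ J → ‖s * a‖ ≤ ε

lemma norm_le_one_of_star_mul_add_star_mul (h : star c * c + star s * s = 1) : ‖s‖ ≤ 1 := by
  let _ := CStarAlgebra.spectralOrder A
  have _ := CStarAlgebra.spectralOrderedRing A
  refine norm_le_of_star_mul_self_le zero_le_one ?_
  rw [one_pow, map_one, ← h]
  exact le_add_of_nonneg_left (star_mul_self_nonneg c)

lemma IsQuasicentralCutoff.norm_le_one (h : IsQuasicentralCutoff J F ε s c) : ‖s‖ ≤ 1 :=
  norm_le_one_of_star_mul_add_star_mul h.star_mul_add_star_mul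

lemma IsQuasicentralCutoff.norm_compl_le_one (h : IsQuasicentralCutoff J F ε s c) : ‖c‖ ≤ 1 :=
  norm_le_one_of_star_mul_add_star_mul ((add_comm _ _).trans h.star_mul_add_star_mul)

lemma isQuasicentralCutoff_of_quasicentral {e : A} (heJ : e ∈ J) (he : IsSelfAdjoint e)
    (he1 : ‖e‖ ≤ 1) (hcomm : ∀ x ∈ F, ‖e * x - x * e‖ ≤ ε)
    (hunit : ∀ a ∈ F, a ∈ J → ‖a - e * a‖ ≤ ε) :
    IsQuasicentralCutoff J F (2 * ε) (cayleyRe (Complex.I • e)) (cayleySkew (Complex.I • e)) := by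
  have hz : Complex.I • e ∈ skewAdjoint A := by simp [skewAdjoint.mem_iff, he.star_eq]
  have hzz : 1 + (Complex.I • e) * (Complex.I • e) = 1 - e * e := by
    simp [smul_smul, sub_eq_add_neg]
  have hzcomm (x) (hx : x ∈ F) : 2 * ‖(Complex.I • e) * x - x * (Complex.I • e)‖ ≤ 2 * ε := by
    simpa [← smul_sub, norm_smul] using hcomm x hx
  refine ⟨isSelfAdjoint_cayleyRe hz, star_cayleySkew_mul_add_star_cayleyRe_mul hz, ?_,
    fun x hx => (norm_cayleyRe_commutator_le hz x).trans (hzcomm x hx),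
    fun x hx => (norm_cayleySkew_commutator_le hz x).trans (hzcomm x hx), fun a haF haJ => ?_⟩
  · rw [one_sub_cayleyRe hz]
    exact J.mul_mem_left _ (Submodule.smul_of_tower_mem J _ heJ)
  · rw [cayleyRe_eq_mul hz, hzz, mul_assoc, mul_assoc]
    exact (norm_cayleyResolvent_mul_le hz _).trans
      ((norm_cayleyResolvent_mul_le (neg_mem hz) _).trans
        (norm_one_sub_mul_self_mul_le he1 (hunit a haF haJ)))

lemma IsQuasicentralCutoff.norm_add_conj_le (h : IsQuasicentralCutoff J F ε s c) {d b : A}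
    (hd : d ∈ F) (hdb : d - b ∈ F) (hdbJ : d - b ∈ J) (w : A) :
    ‖d + s * w * s‖ ≤ max ‖d‖ ‖b + w‖ + 3 * ε := by
  have hdecomp : d + s * w * s = (star c * d * c + star s * (b + w) * s)
      + s * (d - b) * s + (star c * (c * d - d * c) + s * (s * d - d * s)) := by
    have hsc := h.star_mul_add_star_mul
    rw [h.isSelfAdjoint.star_eq] at hsc ⊢
    linear_combination (norm := noncomm_ring) -hsc * d
  have hkill : ‖s * (d - b) * s‖ ≤ ε :=
    norm_mul_le_of_norm_le_one_right h.norm_le_one (h.norm_mul_le_of_mem _ hdb hdbJ)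
  have hc : ‖star c * (c * d - d * c)‖ ≤ ε :=
    norm_mul_le_of_norm_le_one_left ((norm_star c).trans_le h.norm_compl_le_one)
      (h.norm_compl_commutator_le d hd)
  have hs : ‖s * (s * d - d * s)‖ ≤ ε :=
    norm_mul_le_of_norm_le_one_left h.norm_le_one (h.norm_commutator_le d hd)
  rw [hdecomp]
  refine (norm_add_le_of_le (norm_add_le_of_le
    (norm_conj_add_conj_le h.star_mul_add_star_mul d (b + w)) hkill)
    (norm_add_le_of_le hc hs)).trans_eq (by ring)

lemma conj_mem_skewAdjoint {a : A} (ha : a ∈ skewAdjoint A) (hs : IsSelfAdjoint s) :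
    s * a * s ∈ skewAdjoint A := by
  simpa [hs.star_eq] using skewAdjoint.conjugate ha s

lemma norm_resolvent_sandwich_sub_le {z k : A} (hz : z ∈ skewAdjoint A) (hs : ‖s‖ ≤ 1)
    (hzs : ‖z * s - s * z‖ ≤ ε) :
    ‖cayleyResolvent z * (s * k * s) * cayleyResolvent (-z)
      - s * (cayleyResolvent z * k * cayleyResolvent (-z)) * s‖ ≤ 2 * ‖k‖ * ε := by
  set r := cayleyResolvent z
  set r' := cayleyResolvent (-z)
  have hr : ‖r * s - s * r‖ ≤ ε := (norm_cayleyResolvent_commutator_le hz s).trans hzs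
  have hr' : ‖r' * s - s * r'‖ ≤ ε := (norm_cayleyResolvent_neg_commutator_le hz s).trans hzs
  have hdecomp : r * (s * k * s) * r' - s * (r * k * r') * s
      = (r * s - s * r) * k * s * r' - s * (r * (k * (r' * s - s * r'))) := by noncomm_ring
  rw [hdecomp]
  refine (norm_sub_le_of_le
    ((norm_mul_cayleyResolvent_le (neg_mem hz) _).trans
      (norm_mul_le_of_norm_le_one_right hs (norm_mul_le_of_le hr le_rfl)))
    (norm_mul_le_of_norm_le_one_left hs
      ((norm_cayleyResolvent_mul_le hz _).trans (norm_mul_le_of_le le_rfl hr')))).trans_eq (by ring)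

lemma norm_cayley_conj_sub_sub_le {a t : A} (ha : a ∈ skewAdjoint A) (hs : IsSelfAdjoint s)
    (hs1 : ‖s‖ ≤ 1) (hsa : ‖s * a - a * s‖ ≤ ε) (hst : ‖s * t - t * s‖ ≤ ε) :
    ‖cayley (s * a * s) * t * star (cayley (s * a * s)) - t
      - s * (2 * (cayleyResolvent (s * a * s) * (a * t - t * a)
        * cayleyResolvent (-(s * a * s)))) * s‖
      ≤ (4 * ‖a‖ + 8 * ‖a‖ * ‖t‖) * ε := by
  set z := s * a * s with hz
  have hskew : z ∈ skewAdjoint A := conj_mem_skewAdjoint ha hs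
  have hzs : ‖z * s - s * z‖ ≤ ε := by
    have : z * s - s * z = s * -(s * a - a * s) * s := by rw [hz]; noncomm_ring
    rw [this]
    exact norm_mul_le_of_norm_le_one_right hs1
      (norm_mul_le_of_norm_le_one_left hs1 ((norm_neg _).trans_le hsa))
  have hε : 0 ≤ ε := (norm_nonneg _).trans hsa
  set k := a * t - t * a
  set r := cayleyResolvent z
  set r' := cayleyResolvent (-z)
  have hcomm : ‖r * ((z * t - t * z) - s * k * s) * r'‖ ≤ 2 * ‖a‖ * ε :=
    (norm_mul_cayleyResolvent_le (neg_mem hskew) _).trans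
      ((norm_cayleyResolvent_mul_le hskew _).trans (norm_commutator_conj_sub_le hs1 hst))
  have hsandwich : ‖r * (s * k * s) * r' - s * (r * k * r') * s‖ ≤ 2 * (2 * (‖a‖ * ‖t‖)) * ε :=
    (norm_resolvent_sandwich_sub_le hskew hs1 hzs).trans
      (by gcongr; exact norm_mul_sub_mul_le a t)
  rw [cayley_conj_sub hskew]
  have hdecomp : 2 * (r * (z * t - t * z) * r') - s * (2 * (r * k * r')) * s
      = (2 : ℝ) • (r * ((z * t - t * z) - s * k * s) * r'
        + (r * (s * k * s) * r' - s * (r * k * r') * s)) := by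
    rw [two_smul]
    noncomm_ring
  rw [hdecomp, norm_smul, Real.norm_ofNat]
  linarith [norm_add_le_of_le hcomm hsandwich]

lemma IsQuasicentralCutoff.norm_cayley_conj_sub_le (h : IsQuasicentralCutoff J F ε s c)
    {a t x b : A} (ha : a ∈ skewAdjoint A) (haF : a ∈ F) (ht : t ∈ F) (htx : t - x ∈ F)
    (htxb : t - x - b ∈ F) (htxbJ : t - x - b ∈ J) :
    ‖cayley (s * a * s) * t * star (cayley (s * a * s)) - x‖
      ≤ max ‖t - x‖ (‖b‖ + 4 * ‖a‖ * ‖t‖) + (3 + 4 * ‖a‖ + 8 * ‖a‖ * ‖t‖) * ε := by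
  have hskew := conj_mem_skewAdjoint ha h.isSelfAdjoint
  set z := s * a * s
  set w := 2 * (cayleyResolvent z * (a * t - t * a) * cayleyResolvent (-z))
  have hw : ‖w‖ ≤ 4 * ‖a‖ * ‖t‖ := by
    have hk : ‖cayleyResolvent z * (a * t - t * a) * cayleyResolvent (-z)‖ ≤ 2 * (‖a‖ * ‖t‖) :=
      (norm_mul_cayleyResolvent_le (neg_mem hskew) _).trans
        ((norm_cayleyResolvent_mul_le hskew _).trans (norm_mul_sub_mul_le a t))
    rw [show w = _ from two_mul _]
    linarith [norm_add_le_of_le hk hk]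
  have hmain : ‖t - x + s * w * s‖ ≤ max ‖t - x‖ (‖b‖ + 4 * ‖a‖ * ‖t‖) + 3 * ε :=
    (h.norm_add_conj_le htx htxb htxbJ w).trans
      (add_le_add_left (max_le_max le_rfl (norm_add_le_of_le le_rfl hw)) _)
  have herror := norm_cayley_conj_sub_sub_le ha h.isSelfAdjoint h.norm_le_one
    (h.norm_commutator_le a haF) (h.norm_commutator_le t ht)
  have hdecomp : cayley z * t * star (cayley z) - x
      = (t - x + s * w * s) + (cayley z * t * star (cayley z) - t - s * w * s) := by abel
  rw [hdecomp]
  exact (norm_add_le_of_le hmain herror).trans_eq (by ring)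

end Cutoff

section OneStep

variable {A : Type*} [CStarAlgebra A] {J : Ideal A} [J.IsTwoSided]

lemma HasApproximateUnit.exists_cutoff (hJ : HasApproximateUnit J) {F : Set A} (hF : F.Finite)
    {ε : ℝ} (hε : 0 < ε) : ∃ s c, IsQuasicentralCutoff J F ε s c := by
  obtain ⟨e, heJ, he, he1, hcomm, hunit⟩ := hJ.exists_quasicentral hF (half_pos hε)
  have h := isQuasicentralCutoff_of_quasicentral heJ he he1 hcomm hunit
  rw [mul_div_cancel₀ ε two_ne_zero] at h
  exact ⟨_, _, h⟩

lemma HasApproximateUnit.exists_cayley_conj_le (hJ : HasApproximateUnit J) {a : A}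
    (ha : a ∈ skewAdjoint A) {G : Set A} (hG : G.Finite) {δ : ℝ} (hδ : 0 < δ) :
    ∃ z ∈ skewAdjoint A, a - z ∈ J ∧ (∀ x ∈ G, x ∈ J → ‖z * x‖ ≤ δ) ∧
      ∀ t ∈ G, ∀ x ∈ G, ‖cayley z * t * star (cayley z) - x‖
        ≤ max ‖t - x‖ (‖(Submodule.Quotient.mk (t - x) : A ⧸ J)‖ + 4 * ‖a‖ * ‖t‖) + δ := by
  choose b hbJ hb using fun d : A =>
    Submodule.Quotient.norm_mk_lt (S := J) (Submodule.Quotient.mk d) (half_pos hδ)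
  obtain ⟨C, hC, hGC⟩ := hG.isBounded.exists_pos_norm_le
  set ε := δ / 2 / (3 + 4 * ‖a‖ + 8 * ‖a‖ * C)
  have hεK : (3 + 4 * ‖a‖ + 8 * ‖a‖ * C) * ε = δ / 2 := mul_div_cancel₀ _ (by positivity)
  have hε0 : 0 < ε := by positivity
  set D := Set.image2 (· - ·) G G
  have hD : D.Finite := hG.image2 _ hG
  obtain ⟨s, c, hs⟩ := hJ.exists_cutoff
    (((hG.union hD).union (hD.image fun d => d - b d)).insert a) hε0
  have haJ : a - s * a * s ∈ J := by
    have hfac : a - s * a * s = (1 - s) * a + s * a * (1 - s) := by noncomm_ring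
    rw [hfac]
    exact add_mem (J.mul_mem_right _ hs.one_sub_mem) (J.mul_mem_left _ hs.one_sub_mem)
  refine ⟨s * a * s, conj_mem_skewAdjoint ha hs.isSelfAdjoint, haJ, fun x hx hxJ => ?_,
    fun t ht x hx => ?_⟩
  · have hsx : ‖s * x‖ ≤ ε := hs.norm_mul_le_of_mem x (by simp [hx]) hxJ
    calc ‖s * a * s * x‖ = ‖s * (a * (s * x))‖ := by simp only [mul_assoc]
      _ ≤ ‖a‖ * ε := norm_mul_le_of_norm_le_one_left hs.norm_le_one (norm_mul_le_of_le le_rfl hsx)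
      _ ≤ δ := by nlinarith [norm_nonneg a, mul_nonneg (norm_nonneg a) hC.le]
  · have htx : t - x ∈ D := Set.mem_image2_of_mem ht hx
    refine (hs.norm_cayley_conj_sub_le (b := b (t - x)) ha (by simp) (by simp [ht]) (by simp [htx])
      (.inr (.inr (Set.mem_image_of_mem _ htx)))
      ((Submodule.Quotient.eq J).1 (hbJ (t - x)).symm)).trans ?_
    have hmax : max ‖t - x‖ (‖b (t - x)‖ + 4 * ‖a‖ * ‖t‖)
        ≤ max ‖t - x‖ (‖(Submodule.Quotient.mk (t - x) : A ⧸ J)‖ + 4 * ‖a‖ * ‖t‖) + δ / 2 := by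
      rw [max_add]
      exact max_le_max (by linarith) (by linarith [hb (t - x)])
    have herror : (3 + 4 * ‖a‖ + 8 * ‖a‖ * ‖t‖) * ε ≤ δ / 2 := by
      rw [← hεK]
      gcongr
      exact hGC t ht
    linarith

end OneStep

section Corona

variable {E : Type*} [NonUnitalCStarAlgebra E]

lemma coe_mul_coe (a b : E) : (a : 𝓜(ℂ, E)) * (b : 𝓜(ℂ, E)) = ((a * b : E) : 𝓜(ℂ, E)) :=
  (map_mul (DoubleCentralizer.coeHom (𝕜 := ℂ) (A := E)) a b).symm

lemma star_coe (a : E) : star (a : 𝓜(ℂ, E)) = ((star a : E) : 𝓜(ℂ, E)) :=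
  (map_star (DoubleCentralizer.coeHom (𝕜 := ℂ) (A := E)) a).symm

lemma isometry_coe : Isometry fun a : E => (a : 𝓜(ℂ, E)) :=
  AddMonoidHomClass.isometry_of_norm (DoubleCentralizer.coeHom (𝕜 := ℂ) (A := E))
    norm_coe_multiplier

lemma hasApproximateUnit_canonicalIdeal (E : Type*) [NonUnitalCStarAlgebra E] :
    HasApproximateUnit (canonicalIdeal E) := by
  let _ := CStarAlgebra.spectralOrder E
  have _ := CStarAlgebra.spectralOrderedRing E
  intro F hF hFJ ε hε
  have hunit := CStarAlgebra.increasingApproximateUnit E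
  have : (CStarAlgebra.approximateUnit E).NeBot := hunit.neBot
  have hclose : ∀ᶠ e : E in CStarAlgebra.approximateUnit E,
      ∀ x ∈ F, ‖x - e * x‖ ≤ ε ∧ ‖x - x * e‖ ≤ ε := by
    rw [hF.eventually_all]
    intro x hx
    obtain ⟨a, rfl⟩ := hFJ hx
    have hleft := (hunit.tendsto_mul_left a).eventually (Metric.closedBall_mem_nhds a hε)
    have hright := (hunit.tendsto_mul_right a).eventually (Metric.closedBall_mem_nhds a hε)
    filter_upwards [hleft, hright] with e hl hr
    simp only [coe_mul_coe, ← dist_eq_norm, isometry_coe.dist_eq]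
    exact ⟨by rwa [dist_comm], by rwa [dist_comm]⟩
  obtain ⟨e, he, he1, hesa⟩ :=
    (hclose.and (hunit.eventually_norm.and hunit.eventually_isSelfAdjoint)).exists
  refine ⟨e, ⟨e, rfl⟩, ?_, (norm_coe_multiplier e).trans_le he1, he⟩
  rw [IsSelfAdjoint, star_coe, hesa.star_eq]

lemma Corona.mk_eq_mk_iff_sub_mem {m n : 𝓜(ℂ, E)} :
    Corona.mk E m = Corona.mk E n ↔ m - n ∈ canonicalIdeal E :=
  Corona.mk_eq_mk

lemma Corona.exists_skewAdjoint_lift {z : Corona E} (hz : z ∈ skewAdjoint (Corona E)) {ε : ℝ}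
    (hε : 0 < ε) : ∃ a ∈ skewAdjoint 𝓜(ℂ, E), Corona.mk E a = z ∧ ‖a‖ < ‖z‖ + ε := by
  obtain ⟨m, rfl, hm⟩ := Corona.exists_norm_lt z hε
  rw [skewAdjoint.mem_iff, Corona.star_mk] at hz
  refine ⟨(2⁻¹ : ℂ) • (m - star m), ?_, ?_, ?_⟩
  · rw [skewAdjoint.mem_iff, star_smul, star_sub, star_star, star_inv₀, star_ofNat, ← smul_neg,
      neg_sub]
  · rw [map_smul, map_sub, hz, sub_neg_eq_add, ← two_smul ℂ, inv_smul_smul₀ two_ne_zero]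
  · have := norm_sub_le m (star m)
    rw [norm_star] at this
    rw [norm_smul, norm_inv, Complex.norm_ofNat]
    linarith

lemma exists_unitary_lift {v : Corona E} (hv : v ∈ unitary (Corona E)) (hv1 : ‖v - 1‖ ≤ 1)
    {G : Set 𝓜(ℂ, E)} (hG : G.Finite) {δ : ℝ} (hδ : 0 < δ) :
    ∃ g ∈ unitary 𝓜(ℂ, E), Corona.mk E g = v ∧
      (∀ x ∈ G, x ∈ canonicalIdeal E → ‖g * x - x‖ ≤ δ ∧ ‖star g * x - x‖ ≤ δ) ∧
      ∀ t ∈ G, ∀ x ∈ G, ‖g * t * star g - x‖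
        ≤ max ‖t - x‖ (‖Corona.mk E (t - x)‖ + 4 * ‖v - 1‖ * ‖t‖) + δ := by
  obtain ⟨z₀, hz₀, hz₀v, hcayley⟩ := exists_cayley_eq_of_norm_sub_one_le hv hv1
  obtain ⟨C, hC, hGC⟩ := hG.isBounded.exists_pos_norm_le
  obtain ⟨a, ha, haz₀, han⟩ := Corona.exists_skewAdjoint_lift hz₀
    (show 0 < δ / (8 * C) by positivity)
  obtain ⟨z, hz, haz, hzJ, hconj⟩ :=
    (hasApproximateUnit_canonicalIdeal E).exists_cayley_conj_le ha hG (half_pos hδ)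
  have hmk : Corona.mk E z = z₀ := (Corona.mk_eq_mk_iff_sub_mem.2 haz).symm.trans haz₀
  refine ⟨cayley z, cayley_mem_unitary hz, ?_, fun x hx hxJ => ⟨?_, ?_⟩, fun t ht x hx => ?_⟩
  · rw [← hcayley, ← hmk]
    exact map_cayley (Corona.mk E).toRingHom hz (hmk ▸ hz₀)
  · have := norm_cayley_sub_one_mul_le hz x
    rw [sub_one_mul] at this
    linarith [hzJ x hx hxJ]
  · have := norm_cayley_sub_one_mul_le (neg_mem hz) x
    rw [sub_one_mul, neg_mul, norm_neg] at this
    rw [star_cayley hz]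
    linarith [hzJ x hx hxJ]
  · have hat : 4 * ‖a‖ * ‖t‖ ≤ 4 * ‖v - 1‖ * ‖t‖ + δ / 2 := by
      have : δ / (8 * C) * ‖t‖ ≤ δ / 8 := by
        rw [div_mul_eq_mul_div, div_le_div_iff₀ (by positivity) (by norm_num)]
        nlinarith [hGC t ht]
      nlinarith [norm_nonneg t]
    have hmax : max ‖t - x‖ (‖Corona.mk E (t - x)‖ + 4 * ‖a‖ * ‖t‖)
        ≤ max ‖t - x‖ (‖Corona.mk E (t - x)‖ + 4 * ‖v - 1‖ * ‖t‖) + δ / 2 := by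
      rw [max_add]
      exact max_le_max (by linarith) (by linarith)
    refine (hconj t ht x hx).trans ?_
    calc _ ≤ _ := add_le_add_left hmax (δ / 2)
      _ = _ := by ring

end Corona

section Sequences

lemma exists_seq_of_forall_finite {α : Type*} (a : α) {R : ℕ → α → α → α → Prop}
    (hR : ∀ n (s : Set α), s.Finite → ∀ p, ∃ q, ∀ m ∈ s, R n m p q) :
    ∃ f : ℕ → α, f 0 = a ∧ ∀ m n, m ≤ n → R n (f m) (f n) (f (n + 1)) := by
  choose! next hnext using hR
  let state : ℕ → Set α × α := fun n =>
    Nat.rec (∅, a) (fun n p => (insert p.2 p.1, next n (insert p.2 p.1) p.2)) n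
  have hfin : ∀ n, (state n).1.Finite := fun n =>
    Nat.rec Set.finite_empty (fun _ h => h.insert _) n
  have hmem : ∀ m n, m ≤ n → (state m).2 ∈ (state (n + 1)).1 := by
    intro m n hmn
    induction n, hmn using Nat.le_induction with
    | base => exact Set.mem_insert _ _
    | succ n _ ih => exact Set.mem_insert_of_mem _ ih
  exact ⟨fun n => (state n).2, rfl, fun m n hmn =>
    hnext n _ (hfin (n + 1)) _ _ (hmem m n hmn)⟩

lemma le_add_sum_of_le_max_add {r γ : ℕ → ℝ} {n : ℕ} {η : ℝ} (hγ : ∀ k, 0 ≤ γ k) (hn : r n ≤ η)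
    (hr : ∀ k, n ≤ k → r (k + 1) ≤ max (r k) η + γ k) {k : ℕ} (hk : n ≤ k) :
    r k ≤ η + ∑ i ∈ Finset.Ico n k, γ i := by
  induction k, hk using Nat.le_induction with
  | base => simpa using hn
  | succ k hk ih =>
    have hη : η ≤ η + ∑ i ∈ Finset.Ico n k, γ i :=
      le_add_of_nonneg_right (Finset.sum_nonneg fun i _ => hγ i)
    rw [Finset.sum_Ico_succ_top hk, ← add_assoc]
    exact (hr k hk).trans (add_le_add_left (max_le ih hη) _)

lemma cauchySeq_of_dist_succ_le_max {X : Type*} [PseudoMetricSpace X] {x : ℕ → X} {β γ : ℕ → ℝ}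
    (N : ℕ) (hβ : Tendsto β atTop (𝓝 0)) (hγ0 : ∀ k, 0 ≤ γ k) (hγ : Summable γ)
    (hx : ∀ n k, N ≤ n → n ≤ k →
      dist (x (k + 1)) (x n) ≤ max (dist (x k) (x n)) (β k + β n) + γ k) :
    CauchySeq x := by
  rw [Metric.cauchySeq_iff']
  intro ε hε
  obtain ⟨n, hn⟩ := eventually_atTop.1
    (((hβ.eventually (gt_mem_nhds (show 0 < ε / 4 by positivity))).and
      ((tendsto_sum_nat_add γ).eventually (gt_mem_nhds (half_pos hε)))).and (eventually_ge_atTop N))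
  obtain ⟨⟨hβn, hγn⟩, hNn⟩ := hn n le_rfl
  refine ⟨n, fun k hk => ?_⟩
  have htail : ∑ i ∈ Finset.Ico n k, γ i ≤ ∑' i, γ (i + n) := by
    rw [Finset.sum_Ico_eq_sum_range]
    simp only [add_comm n]
    exact ((summable_nat_add_iff n).2 hγ).sum_le_tsum _ fun i _ => hγ0 _
  have hdist := le_add_sum_of_le_max_add (r := fun k => dist (x k) (x n)) (η := ε / 2) hγ0
    (by simpa using (half_pos hε).le)
    (fun k hk => (hx n k hNn hk).trans (add_le_add_left (max_le_max le_rfl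
      (by linarith [(hn k hk).1.1])) _)) hk
  linarith

lemma cauchySeq_of_forall_exists_dist_le {X : Type*} [PseudoMetricSpace X] {x : ℕ → X}
    (hx : ∀ ε > 0, ∃ y : ℕ → X, CauchySeq y ∧ ∀ n, dist (x n) (y n) ≤ ε) : CauchySeq x := by
  rw [Metric.cauchySeq_iff']
  intro ε hε
  obtain ⟨y, hy, hxy⟩ := hx (ε / 3) (by positivity)
  obtain ⟨N, hN⟩ := Metric.cauchySeq_iff'.1 hy (ε / 3) (by positivity)
  refine ⟨N, fun n hn => (dist_triangle4_right _ _ (y n) (y N)).trans_lt ?_⟩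
  linarith [hxy n, hxy N, hN n hn]

end Sequences

section StrictTopology

variable {E : Type*} [NonUnitalCStarAlgebra E]

lemma Corona.continuous_mk : Continuous (Corona.mk E) :=
  AddMonoidHomClass.continuous_of_bound (Corona.mk E) 1 fun m => by
    simpa using Corona.norm_mk_le m

lemma multiplier_ext {m n : 𝓜(ℂ, E)} (h : ∀ a : E, m.fst a = n.fst a) : m = n := by
  rw [← sub_eq_zero, ← norm_eq_zero, ← DoubleCentralizer.norm_fst, norm_eq_zero]
  ext a
  simp [h a]

lemma fst_mul (m : 𝓜(ℂ, E)) (a b : E) : m.fst (a * b) = m.fst a * b := by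
  have hmul : ∀ c, c * (m.fst a * b - m.fst (a * b)) = 0 := fun c => by
    rw [mul_sub, ← mul_assoc, ← m.central, ← m.central, mul_assoc, sub_self]
  exact (sub_eq_zero.1 (CStarRing.star_mul_self_eq_zero_iff _ |>.1 (hmul _))).symm

lemma mul_coe (m : 𝓜(ℂ, E)) (a : E) : m * (a : 𝓜(ℂ, E)) = (m.fst a : 𝓜(ℂ, E)) :=
  multiplier_ext fun b => by simpa using fst_mul m a b

lemma coe_mul (a : E) (m : 𝓜(ℂ, E)) : (a : 𝓜(ℂ, E)) * m = (m.snd a : 𝓜(ℂ, E)) := by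
  simpa [star_coe] using congrArg star (mul_coe (star m) (star a))

/-- Convergence of a sequence of multipliers in the strict topology: pointwise convergence of the
left and right multiplications on `E`. -/
def StrictTendsto (W : ℕ → 𝓜(ℂ, E)) (w : 𝓜(ℂ, E)) : Prop :=
  ∀ a : E, Tendsto (fun n => W n * (a : 𝓜(ℂ, E))) atTop (𝓝 (w * a)) ∧
    Tendsto (fun n => (a : 𝓜(ℂ, E)) * W n) atTop (𝓝 (a * w))

lemma strictTendsto_of_tendsto {W : ℕ → 𝓜(ℂ, E)} {w : 𝓜(ℂ, E)} (hW : Tendsto W atTop (𝓝 w)) :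
    StrictTendsto W w :=
  fun _ => ⟨hW.mul_const _, hW.const_mul _⟩

namespace StrictTendsto

variable {V W : ℕ → 𝓜(ℂ, E)} {v w : 𝓜(ℂ, E)}

protected lemma star (hW : StrictTendsto W w) : StrictTendsto (fun n => star (W n)) (star w) :=
  fun a => ⟨by simpa [← star_coe] using (hW (star a)).2.star,
    by simpa [← star_coe] using (hW (star a)).1.star⟩

protected lemma mul {C D : ℝ} (hV : StrictTendsto V v) (hVC : ∀ n, ‖V n‖ ≤ C)
    (hW : StrictTendsto W w) (hWD : ∀ n, ‖W n‖ ≤ D) :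
    StrictTendsto (fun n => V n * W n) (v * w) := by
  intro a
  obtain ⟨b, hb⟩ := (canonicalIdeal E).mul_mem_left w ⟨a, rfl⟩
  obtain ⟨b', hb'⟩ := (canonicalIdeal E).mul_mem_right v ⟨a, rfl⟩
  constructor
  · have herror := isBoundedUnder_le_mul_tendsto_zero (isBoundedUnder_of ⟨C, hVC⟩)
      (tendsto_sub_nhds_zero_iff.2 (hW a).1)
    simpa [mul_sub, mul_assoc, ← hb] using herror.add (hV b).1
  · have herror := (tendsto_sub_nhds_zero_iff.2 (hV a).2).zero_mul_isBoundedUnder_le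
      (isBoundedUnder_of ⟨D, hWD⟩)
    simpa [sub_mul, ← mul_assoc, ← hb'] using herror.add (hW b').2

lemma unique (hV : StrictTendsto W v) (hW : StrictTendsto W w) : v = w := by
  refine multiplier_ext fun a => isometry_coe.injective ?_
  simpa only [mul_coe] using tendsto_nhds_unique (hV a).1 (hW a).1

end StrictTendsto

lemma cauchySeq_mul_coe {W : ℕ → 𝓜(ℂ, E)} {C : ℝ} (hW : ∀ n, ‖W n‖ ≤ C) {h : ℕ → E}
    (hh : ∀ a : E, Tendsto (fun n => h n * a) atTop (𝓝 a))
    (hc : ∀ j, CauchySeq fun n => W n * (h j : 𝓜(ℂ, E))) (a : E) :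
    CauchySeq fun n => W n * (a : 𝓜(ℂ, E)) := by
  refine cauchySeq_of_forall_exists_dist_le fun ε hε => ?_
  have hlim : Tendsto (fun j => C * ‖a - h j * a‖) atTop (𝓝 0) := by
    simpa using ((hh a).const_sub a).norm.const_mul C
  obtain ⟨j, hj⟩ := (hlim.eventually (gt_mem_nhds hε)).exists
  obtain ⟨l, hl⟩ := cauchySeq_tendsto_of_complete (hc j)
  refine ⟨fun n => W n * (h j : 𝓜(ℂ, E)) * (a : 𝓜(ℂ, E)), (hl.mul_const _).cauchySeq, fun n => ?_⟩
  calc dist (W n * (a : 𝓜(ℂ, E))) (W n * (h j : 𝓜(ℂ, E)) * (a : 𝓜(ℂ, E)))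
      = ‖W n * ((a : 𝓜(ℂ, E)) - ((h j * a : E) : 𝓜(ℂ, E)))‖ := by
        rw [dist_eq_norm, mul_assoc, ← mul_sub, coe_mul_coe]
    _ ≤ C * ‖a - h j * a‖ := norm_mul_le_of_le (hW n) <| by
        rw [← dist_eq_norm, ← dist_eq_norm, isometry_coe.dist_eq]
    _ ≤ ε := hj.le

lemma exists_tendsto_fst {W : ℕ → 𝓜(ℂ, E)} {a : E}
    (hW : CauchySeq fun n => W n * (a : 𝓜(ℂ, E))) :
    ∃ b, Tendsto (fun n => (W n).fst a) atTop (𝓝 b) := by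
  simp only [mul_coe] at hW
  exact cauchySeq_tendsto_of_complete (isometry_coe.isUniformInducing.cauchy_map_iff.1 hW)

lemma exists_strictTendsto {W : ℕ → 𝓜(ℂ, E)} (hl : ∀ a : E, CauchySeq fun n => W n * (a : 𝓜(ℂ, E)))
    (hr : ∀ a : E, CauchySeq fun n => star (W n) * (a : 𝓜(ℂ, E))) :
    ∃ w, StrictTendsto W w := by
  choose f hf using fun a => exists_tendsto_fst (hl a)
  choose g hg using fun a => exists_tendsto_fst (hr (star a))
  have hg' : ∀ a, Tendsto (fun n => (W n).snd a) atTop (𝓝 (star (g a))) := fun a => by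
    simpa using (hg a).star
  let L : E →L[ℂ] E := continuousLinearMapOfTendsto (fun n => (W n).fst) (tendsto_pi_nhds.2 hf)
  let R : E →L[ℂ] E := continuousLinearMapOfTendsto (fun n => (W n).snd) (tendsto_pi_nhds.2 hg')
  have hLR : ∀ a b, R a * b = a * L b := fun a b =>
    tendsto_nhds_unique ((hg' a).mul_const b) <| by
      simp only [(W _).central]
      exact (hf b).const_mul a
  refine ⟨⟨(L, R), hLR⟩, fun a => ⟨?_, ?_⟩⟩
  · simp only [mul_coe]
    exact (isometry_coe.continuous.tendsto _).comp (hf a)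
  · simp only [coe_mul]
    exact (isometry_coe.continuous.tendsto _).comp (hg' a)

end StrictTopology

section Unitary

variable {A : Type*} [NormedRing A] [StarRing A] [CStarRing A]

lemma norm_unitary_conj (u : unitary A) (x : A) :
    ‖(u : A) * x * star (u : A)‖ = ‖x‖ := by
  rw [← Unitary.coe_star, CStarRing.norm_mul_coe_unitary, CStarRing.norm_coe_unitary_mul]

lemma norm_unitary_le_norm_one (u : unitary A) :
    ‖(u : A)‖ ≤ ‖(1 : A)‖ := by
  simpa only [mul_one] using (CStarRing.norm_coe_unitary_mul u (1 : A)).le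

lemma norm_mul_star_sub_one (u v : unitary A) :
    ‖((u * star v : unitary A) : A) - 1‖ = ‖(u : A) - v‖ := by
  rw [← CStarRing.norm_mul_coe_unitary _ v, sub_mul, one_mul, ← Submonoid.coe_mul, mul_assoc,
    Unitary.star_mul_self, mul_one]

end Unitary

section Lifting

variable {E : Type*} [NonUnitalCStarAlgebra E]

/-- The step from a unitary multiplier `V` to a unitary multiplier `V'` whose image in the corona
is `v` times that of `V`: the products with the first `n + 1` terms of `h` change little, and the
conjugates of the first `n + 1` terms of `X` stay close to those by an earlier multiplier `V₀`. -/
structure IsLiftStep (v : Corona E) (h : ℕ → E) (X : ℕ → 𝓜(ℂ, E)) (n : ℕ)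
    (V₀ V V' : unitary 𝓜(ℂ, E)) : Prop where
  mk_eq : Corona.mk E V' = v * Corona.mk E V
  norm_mul_sub_le : ∀ j ≤ n,
    ‖(V' : 𝓜(ℂ, E)) * (h j : 𝓜(ℂ, E)) - V * (h j : 𝓜(ℂ, E))‖ ≤ (1 / 2) ^ n
  norm_star_mul_sub_le : ∀ j ≤ n,
    ‖star (V' : 𝓜(ℂ, E)) * (h j : 𝓜(ℂ, E)) - star (V : 𝓜(ℂ, E)) * (h j : 𝓜(ℂ, E))‖
      ≤ (1 / 2) ^ n
  norm_conj_sub_le : ∀ j ≤ n,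
    ‖V' * X j * star (V' : 𝓜(ℂ, E)) - V₀ * X j * star (V₀ : 𝓜(ℂ, E))‖
      ≤ max ‖V * X j * star (V : 𝓜(ℂ, E)) - V₀ * X j * star (V₀ : 𝓜(ℂ, E))‖
        (‖Corona.mk E (V * X j * star (V : 𝓜(ℂ, E)) - V₀ * X j * star (V₀ : 𝓜(ℂ, E)))‖
          + 4 * ‖v - 1‖ * ‖X j‖) + (1 / 2) ^ n

lemma exists_isLiftStep {v : Corona E} (hv : v ∈ unitary (Corona E)) (hv1 : ‖v - 1‖ ≤ 1)
    (h : ℕ → E) (X : ℕ → 𝓜(ℂ, E)) (n : ℕ) {S : Set (unitary 𝓜(ℂ, E))} (hS : S.Finite)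
    (V : unitary 𝓜(ℂ, E)) : ∃ V', ∀ V₀ ∈ S, IsLiftStep v h X n V₀ V V' := by
  let conj (j : ℕ) (U : unitary 𝓜(ℂ, E)) : 𝓜(ℂ, E) := U * X j * star (U : 𝓜(ℂ, E))
  let G : Set 𝓜(ℂ, E) := ⋃ j ∈ Set.Iic n,
    {(h j : 𝓜(ℂ, E)), V * (h j : 𝓜(ℂ, E))} ∪ conj j '' insert V S
  have hG : G.Finite := (Set.finite_Iic n).biUnion fun j _ =>
    (Set.toFinite _).union ((hS.insert V).image _)
  have hjG : ∀ j ≤ n, {(h j : 𝓜(ℂ, E)), V * (h j : 𝓜(ℂ, E))} ∪ conj j '' insert V S ⊆ G :=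
    fun j hj => Set.subset_biUnion_of_mem (u := fun j =>
      {(h j : 𝓜(ℂ, E)), V * (h j : 𝓜(ℂ, E))} ∪ conj j '' insert V S) hj
  have hhJ : ∀ j, (h j : 𝓜(ℂ, E)) ∈ canonicalIdeal E := fun j => ⟨h j, rfl⟩
  obtain ⟨g, hg, hgv, hgJ, hgconj⟩ := exists_unitary_lift hv hv1 hG (δ := (1 / 2) ^ n)
    (by positivity)
  refine ⟨⟨g, hg⟩ * V, fun V₀ hV₀ => ⟨?_, fun j hj => ?_, fun j hj => ?_, fun j hj => ?_⟩⟩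
  · rw [Submonoid.coe_mul, map_mul, hgv]
  · rw [Submonoid.coe_mul, mul_assoc]
    exact (hgJ _ (hjG j hj (by simp)) ((canonicalIdeal E).mul_mem_left _ (hhJ j))).1
  · rw [Submonoid.coe_mul, star_mul, mul_assoc, ← mul_sub, ← Unitary.coe_star,
      CStarRing.norm_coe_unitary_mul]
    exact (hgJ _ (hjG j hj (by simp)) (hhJ j)).2
  · have hle := hgconj _ (hjG j hj (.inr ⟨V, Set.mem_insert _ _, rfl⟩)) _
      (hjG j hj (.inr ⟨V₀, Set.mem_insert_of_mem _ hV₀, rfl⟩))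
    have hnorm : ‖conj j V‖ = ‖X j‖ := norm_unitary_conj V (X j)
    rw [hnorm] at hle
    simpa only [conj, Submonoid.coe_mul, star_mul, mul_assoc] using hle

/-- A sequence of unitary multipliers starting at `1` whose image in the corona has the same
increments as `u`, every term being a lift step with respect to all the earlier ones. -/
structure IsLiftSeq (u : ℕ → unitary (Corona E)) (h : ℕ → E) (X : ℕ → 𝓜(ℂ, E))
    (V : ℕ → unitary 𝓜(ℂ, E)) : Prop where
  zero : V 0 = 1
  step : ∀ m n, m ≤ n → IsLiftStep (u (n + 1) * star (u n) : unitary (Corona E)) h X n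
    (V m) (V n) (V (n + 1))

lemma exists_isLiftSeq {u : ℕ → unitary (Corona E)}
    (hu : ∀ n, ‖(u (n + 1) : Corona E) - u n‖ ≤ 1) (h : ℕ → E) (X : ℕ → 𝓜(ℂ, E)) :
    ∃ V, IsLiftSeq u h X V := by
  obtain ⟨V, hV0, hV⟩ := exists_seq_of_forall_finite 1 fun n _ hS V =>
    exists_isLiftStep (u (n + 1) * star (u n)).2 ((norm_mul_star_sub_one _ _).trans_le (hu n))
      h X n hS V
  exact ⟨V, hV0, hV⟩

namespace IsLiftSeq

variable {u : ℕ → unitary (Corona E)} {h : ℕ → E} {X : ℕ → 𝓜(ℂ, E)} {V : ℕ → unitary 𝓜(ℂ, E)}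

lemma mk_eq (hV : IsLiftSeq u h X V) (n : ℕ) :
    Corona.mk E (V n) = (u n * star (u 0) : unitary (Corona E)) := by
  induction n with
  | zero => simp [hV.zero]
  | succ n ih =>
    rw [(hV.step n n le_rfl).mk_eq, ih, ← Submonoid.coe_mul, mul_assoc, ← mul_assoc (star (u n)),
      Unitary.star_mul_self, one_mul]

lemma cauchySeq_mul_coe (hV : IsLiftSeq u h X V) (j : ℕ) :
    CauchySeq fun n => (V n : 𝓜(ℂ, E)) * (h j : 𝓜(ℂ, E)) := by
  refine cauchySeq_of_summable_dist
    (summable_geometric_two.of_norm_bounded_eventually_nat ?_)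
  filter_upwards [eventually_ge_atTop j] with n hn
  rw [Real.norm_of_nonneg dist_nonneg, dist_comm, dist_eq_norm]
  exact (hV.step n n le_rfl).norm_mul_sub_le j hn

lemma cauchySeq_star_mul_coe (hV : IsLiftSeq u h X V) (j : ℕ) :
    CauchySeq fun n => star (V n : 𝓜(ℂ, E)) * (h j : 𝓜(ℂ, E)) := by
  refine cauchySeq_of_summable_dist
    (summable_geometric_two.of_norm_bounded_eventually_nat ?_)
  filter_upwards [eventually_ge_atTop j] with n hn
  rw [Real.norm_of_nonneg dist_nonneg, dist_comm, dist_eq_norm]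
  exact (hV.step n n le_rfl).norm_star_mul_sub_le j hn

lemma cauchySeq_conj (hV : IsLiftSeq u h X V)
    (hu : Tendsto (fun n => ‖(u (n + 1) : Corona E) - u n‖) atTop (𝓝 0)) {j : ℕ} {y : Corona E}
    (hy : Tendsto (fun n => Corona.mk E (V n * X j * star (V n : 𝓜(ℂ, E)))) atTop (𝓝 y)) :
    CauchySeq fun n => (V n : 𝓜(ℂ, E)) * X j * star (V n : 𝓜(ℂ, E)) := by
  let T (n : ℕ) : 𝓜(ℂ, E) := V n * X j * star (V n : 𝓜(ℂ, E))
  let β (n : ℕ) : ℝ := ‖Corona.mk E (T n) - y‖ + 4 * ‖(u (n + 1) : Corona E) - u n‖ * ‖X j‖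
  have hβ : Tendsto β atTop (𝓝 0) := by
    simpa only [mul_zero, zero_mul, add_zero] using
      (tendsto_iff_norm_sub_tendsto_zero.1 hy).add ((hu.const_mul 4).mul_const ‖X j‖)
  refine cauchySeq_of_dist_succ_le_max j hβ (fun k => by positivity) summable_geometric_two
    fun m n hm hmn => ?_
  have hmk : ‖Corona.mk E (T n - T m)‖ ≤ ‖Corona.mk E (T n) - y‖ + ‖Corona.mk E (T m) - y‖ := by
    rw [map_sub, ← sub_sub_sub_cancel_right _ _ y]
    exact norm_sub_le _ _
  have hβm : ‖Corona.mk E (T m) - y‖ ≤ β m := le_add_of_nonneg_right (by positivity)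
  have hstep := (hV.step m n hmn).norm_conj_sub_le j (hm.trans hmn)
  rw [norm_mul_star_sub_one] at hstep
  simp only [dist_eq_norm]
  refine hstep.trans (add_le_add_left (max_le_max le_rfl ?_) _)
  calc ‖Corona.mk E (T n - T m)‖ + 4 * ‖(u (n + 1) : Corona E) - u n‖ * ‖X j‖
      ≤ ‖Corona.mk E (T n) - y‖ + ‖Corona.mk E (T m) - y‖
        + 4 * ‖(u (n + 1) : Corona E) - u n‖ * ‖X j‖ := by gcongr
    _ = β n + ‖Corona.mk E (T m) - y‖ := by ring
    _ ≤ β n + β m := by gcongr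

lemma exists_strictTendsto (hV : IsLiftSeq u h X V)
    (hh : ∀ a : E, Tendsto (fun n => h n * a) atTop (𝓝 a)) :
    ∃ w, StrictTendsto (fun n => (V n : 𝓜(ℂ, E))) w := by
  exact CStarExt.exists_strictTendsto
    (CStarExt.cauchySeq_mul_coe (fun n => norm_unitary_le_norm_one (V n)) hh hV.cauchySeq_mul_coe)
    (CStarExt.cauchySeq_mul_coe (fun n => norm_unitary_le_norm_one (star (V n))) hh
      hV.cauchySeq_star_mul_coe)

end IsLiftSeq

lemma StrictTendsto.mem_unitary {V : ℕ → unitary 𝓜(ℂ, E)} {w : 𝓜(ℂ, E)}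
    (hw : StrictTendsto (fun n => (V n : 𝓜(ℂ, E))) w) : w ∈ unitary 𝓜(ℂ, E) := by
  have hone : StrictTendsto (fun _ : ℕ => (1 : 𝓜(ℂ, E))) 1 :=
    strictTendsto_of_tendsto tendsto_const_nhds
  refine ⟨(StrictTendsto.unique ?_ hone), (StrictTendsto.unique ?_ hone)⟩
  · simpa using hw.star.mul (fun n => norm_unitary_le_norm_one (star (V n))) hw
      fun n => norm_unitary_le_norm_one (V n)
  · simpa using hw.mul (fun n => norm_unitary_le_norm_one (V n)) hw.star
      fun n => norm_unitary_le_norm_one (star (V n))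

lemma Corona.mk_mem_unitary {m : 𝓜(ℂ, E)} (hm : m ∈ unitary 𝓜(ℂ, E)) :
    Corona.mk E m ∈ unitary (Corona E) := by
  rw [Unitary.mem_iff, Corona.star_mk, ← map_mul, ← map_mul, Unitary.star_mul_self_of_mem hm,
    Unitary.mul_star_self_of_mem hm, map_one]
  exact ⟨rfl, rfl⟩

lemma exists_unitary_conj_eq_of_norm_sub_le_one {h : ℕ → E}
    (hh : ∀ a : E, Tendsto (fun n => h n * a) atTop (𝓝 a)) {u : ℕ → unitary (Corona E)}
    (hu1 : ∀ n, ‖(u (n + 1) : Corona E) - u n‖ ≤ 1)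
    (hu : Tendsto (fun n => ‖(u (n + 1) : Corona E) - u n‖) atTop (𝓝 0)) {x y : ℕ → Corona E}
    (hxy : ∀ j, Tendsto (fun n => (u n : Corona E) * x j * star (u n : Corona E)) atTop (𝓝 (y j))) :
    ∃ w : unitary (Corona E), ∀ j, (w : Corona E) * x j * star (w : Corona E) = y j := by
  choose X hX using fun j =>
    Corona.mk_surjective ((u 0 : Corona E) * x j * star (u 0 : Corona E))
  obtain ⟨V, hV⟩ := exists_isLiftSeq hu1 h X
  obtain ⟨W, hW⟩ := hV.exists_strictTendsto hh
  have hmk : ∀ j n, Corona.mk E (V n * X j * star (V n : 𝓜(ℂ, E)))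
      = (u n : Corona E) * x j * star (u n : Corona E) := fun j n => by
    have hcancel : ∀ z, star (u 0 : Corona E) * ((u 0 : Corona E) * z) = z := fun z => by
      rw [← mul_assoc, Unitary.coe_star_mul_self, one_mul]
    simp only [map_mul, ← Corona.star_mk, hX, hV.mk_eq, Submonoid.coe_mul, star_mul,
      Unitary.coe_star, star_star, mul_assoc, hcancel]
  refine ⟨⟨Corona.mk E W, Corona.mk_mem_unitary hW.mem_unitary⟩ * u 0, fun j => ?_⟩
  have hlim := hxy j
  simp only [← hmk] at hlim
  obtain ⟨l, hl⟩ := cauchySeq_tendsto_of_complete (hV.cauchySeq_conj hu hlim)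
  have hconj : W * X j * star W = l := by
    have hmul := hW.mul (fun n => norm_unitary_le_norm_one (V n))
      (strictTendsto_of_tendsto (tendsto_const_nhds (x := X j))) fun _ => le_rfl
    exact (hmul.mul (fun n => (CStarRing.norm_coe_unitary_mul (V n) (X j)).le) hW.star
      fun n => norm_unitary_le_norm_one (star (V n))).unique (strictTendsto_of_tendsto hl)
  calc Corona.mk E W * u 0 * x j * star (Corona.mk E W * u 0)
      = Corona.mk E (W * X j * star W) := by
        rw [map_mul, map_mul, hX, ← Corona.star_mk, star_mul]
        simp only [mul_assoc]
    _ = Corona.mk E l := by rw [hconj]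
    _ = y j := tendsto_nhds_unique ((Corona.continuous_mk.tendsto l).comp hl) hlim

lemma exists_unitary_conj_eq {h : ℕ → E}
    (hh : ∀ a : E, Tendsto (fun n => h n * a) atTop (𝓝 a)) {u : ℕ → unitary (Corona E)}
    (hu : Tendsto (fun n => ‖(u (n + 1) : Corona E) - u n‖) atTop (𝓝 0)) {x y : ℕ → Corona E}
    (hxy : ∀ j, Tendsto (fun n => (u n : Corona E) * x j * star (u n : Corona E)) atTop (𝓝 (y j))) :
    ∃ w : unitary (Corona E), ∀ j, (w : Corona E) * x j * star (w : Corona E) = y j := by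
  obtain ⟨N, hN⟩ := eventually_atTop.1 (hu.eventually (ge_mem_nhds one_pos))
  refine exists_unitary_conj_eq_of_norm_sub_le_one (u := fun n => u (n + N)) hh
    (fun n => ?_) ?_ fun j => (hxy j).comp (tendsto_add_atTop_nat N)
  · simpa only [Nat.add_right_comm _ 1 N] using hN (n + N) (Nat.le_add_left N n)
  · simpa only [Nat.add_right_comm _ 1 N, Function.comp_def] using hu.comp (tendsto_add_atTop_nat N)

end Lifting

section Sampling

lemma tendsto_atTop_of_forall_succ_eq_add_floor {t δ : ℕ → ℝ} (hδ : ∀ k, 0 < δ k)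
    (ht : ∀ n, t (n + 1) = t n + δ ⌊t n⌋₊) : Tendsto t atTop atTop := by
  have hmono : Monotone t := monotone_nat_of_le_succ fun n => by
    rw [ht]
    exact le_add_of_nonneg_right (hδ _).le
  rcases tendsto_atTop_of_monotone hmono with htop | ⟨T, hT⟩
  · exact htop
  obtain ⟨m, -, hmin⟩ := (Finset.range (⌊T⌋₊ + 1)).exists_min_image δ ⟨0, by simp⟩
  have hincr : Tendsto (fun n => t (n + 1) - t n) atTop (𝓝 0) := by
    simpa only [sub_self, Function.comp_def] using (hT.comp (tendsto_add_atTop_nat 1)).sub hT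
  have hm : δ m ≤ 0 := ge_of_tendsto' hincr fun n => by
    rw [ht, add_sub_cancel_left]
    exact hmin _ (Finset.mem_range.2
      (Nat.lt_succ_of_le (Nat.floor_le_floor (hmono.ge_of_tendsto hT n))))
  exact absurd (hδ m) hm.not_gt

lemma exists_forall_dist_le_of_le {X : Type*} [PseudoMetricSpace X] {a : ℝ} {u : Set.Ici a → X}
    (hu : Continuous u) (b : ℝ) {ε : ℝ} (hε : 0 < ε) :
    ∃ δ > 0, δ ≤ 1 ∧ ∀ x y : Set.Ici a, (x : ℝ) ≤ b → (y : ℝ) ≤ b → dist x y ≤ δ →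
      dist (u x) (u y) ≤ ε := by
  have hK : IsCompact ((↑) ⁻¹' Set.Icc a b : Set (Set.Ici a)) :=
    isClosed_Ici.isClosedEmbedding_subtypeVal.isCompact_preimage isCompact_Icc
  obtain ⟨δ, hδ, hdist⟩ := Metric.uniformContinuousOn_iff_le.1
    (hK.uniformContinuousOn_of_continuous hu.continuousOn) ε hε
  exact ⟨min δ 1, lt_min hδ one_pos, min_le_right _ _, fun x y hx hy hxy =>
    hdist x ⟨x.2, hx⟩ y ⟨y.2, hy⟩ (hxy.trans (min_le_left _ _))⟩

lemma exists_seq_tendsto_dist_succ {X : Type*} [PseudoMetricSpace X] {a : ℝ} {u : Set.Ici a → X}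
    (hu : Continuous u) : ∃ t : ℕ → Set.Ici a, Tendsto t atTop atTop ∧
      Tendsto (fun n => dist (u (t (n + 1))) (u (t n))) atTop (𝓝 0) := by
  choose δ hδ0 hδ1 hδ using fun k : ℕ =>
    exists_forall_dist_le_of_le hu (k + 2) (Nat.one_div_pos_of_nat (α := ℝ) (n := k))
  let next (x : Set.Ici a) : Set.Ici a :=
    ⟨x + δ ⌊(x : ℝ)⌋₊, le_add_of_le_of_nonneg x.2 (hδ0 _).le⟩
  let t (n : ℕ) : Set.Ici a := next^[n] ⟨a, Set.self_mem_Ici⟩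
  have ht : ∀ n, (t (n + 1) : ℝ) = t n + δ ⌊(t n : ℝ)⌋₊ := fun n => by
    simp only [t, Function.iterate_succ_apply', next]
  have htop : Tendsto (fun n => (t n : ℝ)) atTop atTop :=
    tendsto_atTop_of_forall_succ_eq_add_floor hδ0 ht
  refine ⟨t, tendsto_atTop.2 fun b => htop.eventually_ge_atTop (b : ℝ),
    squeeze_zero (fun _ => dist_nonneg) (fun n => hδ ⌊(t n : ℝ)⌋₊ _ _ ?_ ?_ ?_)
      (tendsto_one_div_add_atTop_nhds_zero_nat.comp (tendsto_nat_floor_atTop.comp htop))⟩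
  · rw [ht]
    linarith [hδ1 ⌊(t n : ℝ)⌋₊, Nat.lt_floor_add_one (t n : ℝ)]
  · linarith [Nat.lt_floor_add_one (t n : ℝ)]
  · rw [Subtype.dist_eq, ht, Real.dist_eq, add_sub_cancel_left, abs_of_pos (hδ0 _)]

end Sampling

lemma Extension.continuous {D E : Type*} [NonUnitalCStarAlgebra D] [NonUnitalCStarAlgebra E]
    (φ : Extension D E) : Continuous φ :=
  AddMonoidHomClass.continuous_of_bound φ 1 fun a => by
    simpa only [one_mul] using NonUnitalStarAlgHom.norm_apply_le φ a

end CStarExt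

theorem mainTheorem10 {D E : Type*} [NonUnitalCStarAlgebra D] [NonUnitalCStarAlgebra E]
    (hD : TopologicalSpace.SeparableSpace D) (hE : CStarExt.IsNonunital E)
    (hσ : CStarExt.IsSigmaUnital E) (φ ψ : CStarExt.Extension D E) :
    CStarExt.AsymptoticallyUnitarilyEquivalent φ ψ ↔
      CStarExt.WeaklyUnitarilyEquivalent φ ψ := by
  constructor
  · rintro ⟨u, hu, hconj⟩
    obtain ⟨h, -, hh⟩ := hσ
    obtain ⟨t, ht, hdist⟩ := CStarExt.exists_seq_tendsto_dist_succ hu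
    simp only [Subtype.dist_eq, dist_eq_norm] at hdist
    obtain ⟨w, hw⟩ := CStarExt.exists_unitary_conj_eq (fun a => (hh a).1) hdist
      fun j => (hconj (TopologicalSpace.denseSeq D j)).comp ht
    have hcont : Continuous fun a => (w : CStarExt.Corona E) * φ a * star (w : CStarExt.Corona E) :=
      (continuous_const.mul φ.continuous).mul continuous_const
    exact ⟨w, congrFun ((TopologicalSpace.denseRange_denseSeq D).equalizer hcont ψ.continuous
      (funext hw))⟩
  · rintro ⟨w, hw⟩
    exact ⟨fun _ => w, continuous_const, fun a => by simp only [hw]; exact tendsto_const_nhds⟩
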